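/- **Setting.** Let $\mathcal G$ be a finite directed graph (loops allowed), $n_i$ the out-degree of vertex $i$; a vertex is *terminal* if $n_i=0$. Suppose $\mathcal G$ is *terminating*: every vertex has a directed path to a terminal vertex. Each terminal vertex $k$ carries a value $v_k>0$. In the Path Guessing Game started at $i$ the Guesser has fortune $1$. At a non-terminal vertex $i$ she announces a wager $w\in[0,1]$ (a proportion of her fortune $F$) and secretly draws a guess among the successors of $i$; knowing the wager but not the guess, the Chooser draws a successor $j$, independently of the guess given the past. Her fortune becomes $F+(n_i-1)wF$ if the guess is correct and $n_i\ge2$, $F+wF$ if it is correct and $n_i=1$, and $F-wF$ if it is incorrect; play continues at $j$. On reaching a terminal vertex $k$ her fortune is multiplied by $v_k$ and the game ends. $X_t$ is the position and $F_t$ the fortune at time $t$, $T$ is the hitting time of the terminal vertices. Strategies may depend on the whole past; wagers are deterministic functions of the past, guesses and choices may be randomized. A Chooser strategy is *positional* if its transition probabilities depend only on the current vertex, and *guess-blind* if they do not depend on the Guesser's earlier guesses (they may depend on the vertices visited and on the wagers). The *payoff* of a pair of strategies is $E[F_T]$ if $T<\infty$ almost surely, and $\limsup_{t}E[F_t]$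 otherwise. A Chooser strategy is *optimal from $i$* if, among all Chooser strategies, it minimizes the supremum of the payoff over all Guesser strategies. A Guesser strategy is *optimal from $i$* if, among all Guesser strategies, it maximizes the infimum of $E[F_T]$ over all guess-blind Chooser strategies against which the game ends almost surely. Let $M$ be the matrix with $M_{ii}=1$ for $i$ terminal, $M_{ij}=\tfrac12$ if $n_i=1$ and $i\to j$, $M_{ij}=1/n_i$ if $n_i\ge2$ and $i\to j$, and $M_{ij}=0$ otherwise. Let $u_0(k)=1/v_k$ for $k$ terminal and $u_0(i)=1$ otherwise. **Theorem (Optimal play on terminating graphs).** 1. The limit $u=\lim_{s\to\infty}M^su_0$ exists, is strictly positive, and is the unique solution of $Mu=u$ with $u_k=1/v_k$ at all terminal $k$. Put $v_i=1/u_i$. 2. (Chooser) The strategy with transition probabilities, for $i\to j$, $p_{i,j}=1$ if $n_i=1$ and $p_{i,j}=u_j/\sum_{k:i\to k}u_k$ if $n_i\ge2$, exists and is optimal from every $i$. Against every Guesser strategy it makes the game end almost surely, with $E[F_T\mid X_0=i]\le v_i$. 3. (Guesser) Let $\beta\in[0,1]$ and $p_{i,\min}=\min\{p_{i,j}:i\to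 j\}$. The strategy with wager $w_i=1$ and guess probability $g_{i,j}=1$ if $n_i=1$, and $$w_i=1-n_i\beta p_{i,\min},\qquad g_{i,j}=\frac{p_{i,j}-\beta p_{i,\min}}{1-n_i\beta p_{i,\min}}\quad(i\to j)$$ if $n_i\ge2$ (the guess being arbitrary when $w_i=0$), exists and is optimal from every $i$. Against every guess-blind Chooser strategy for which the game ends almost surely, $E[F_T\mid X_0=i]=v_i$. In particular this holds against the strategy in 2. 4. If a positional Chooser strategy is optimal from $i$, then against every Guesser strategy the game started at $i$ ends almost surely; and against every Guesser strategy that is optimal from $i$, $E[F_T\mid X_0=i]=v_i$. Thus the reciprocal values $u^*$ of optimal play satisfy $Mu^*=u^*$, and $u^*=u$. -/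

import Mathlib

open Filter Topology
open scoped ENNReal Matrix

namespace PathGuessing

section Graph

variable {V : Type*} [Fintype V] [DecidableEq V] (G : Digraph V) [DecidableRel G.Adj]

/-- The out-degree `n_i` of a vertex. -/
def outDeg (i : V) : ℕ := (Finset.univ.filter fun j => G.Adj i j).card

/-- A terminal node is a vertex of out-degree zero. -/
def IsTerminal (i : V) : Prop := outDeg G i = 0

instance (i : V) : Decidable (IsTerminal G i) := inferInstanceAs (Decidable (outDeg G i = 0))

/-- A terminating graph: every vertex has a directed path to some terminal node. -/
def IsTerminating : Prop :=
  ∀ i, ∃ k, IsTerminal G k ∧ Relation.ReflTransGen G.Adj i k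

/-- The propagation matrix `M`. -/
noncomputable def propMatrix : Matrix V V ℝ := fun i j =>
  if IsTerminal G i then (if i = j then 1 else 0)
  else if G.Adj i j then (if outDeg G i = 1 then 1 / 2 else 1 / (outDeg G i : ℝ))
  else 0

/-- The vector `u₀`: reciprocals of the given values at the terminal nodes, one elsewhere. -/
noncomputable def initialRecip (val : V → ℝ) : V → ℝ := fun i =>
  if IsTerminal G i then (val i)⁻¹ else 1

/-- The Chooser's transition probabilities `p_{i,j}` for a vector `u` of reciprocal values. -/
noncomputable def chooserProb (u : V → ℝ) (i j : V) : ℝ :=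
  if G.Adj i j then
    (if outDeg G i = 1 then 1 else u j / ∑ k ∈ Finset.univ.filter (fun k => G.Adj i k), u k)
  else 0

/-- `p_{i,min}`, the least of the `p_{i,j}` over the edges `i → j` (a finite set of reals, nonempty
when `i` is not terminal). -/
noncomputable def chooserProbMin (u : V → ℝ) (i : V) : ℝ :=
  sInf (chooserProb G u i '' {j | G.Adj i j})

end Graph

section Game

/-- The record of one round of play: the vertex at which it took place, the wager (as a proportion
of the Guesser's fortune), the Guesser's guess, and the Chooser's choice. -/
structure Round (V : Type*) where
  node : V
  wager : ℝ
  guess : V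
  choice : V

/-- The record of all completed rounds, most recent first. -/
abbrev History (V : Type*) := List (Round V)

variable {V : Type*} [Fintype V] [DecidableEq V] (G : Digraph V) [DecidableRel G.Adj]

/-- A strategy of the Guesser: given the history and the current vertex she announces a wager (a
proportion of her fortune) and draws, at random, a guess among the successors. -/
structure GuesserStrategy where
  wager : History V → V → ℝ
  wager_nonneg : ∀ h i, 0 ≤ wager h i
  wager_le_one : ∀ h i, wager h i ≤ 1
  guess : History V → V → PMF V
  guess_adj : ∀ h i, ¬ IsTerminal G i → ∀ j, guess h i j ≠ 0 → G.Adj i j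

/-- A strategy of the Chooser: given the history, the current vertex and the wager just announced
(but not the current guess) he draws, at random, a successor. -/
structure ChooserStrategy where
  choose : History V → V → ℝ → PMF V
  choose_adj : ∀ h i w, ¬ IsTerminal G i → ∀ j, choose h i w j ≠ 0 → G.Adj i j

/-- The Guesser's fortune after the rounds in a history, before any multiplication by a terminal
value; she starts with one dollar. -/
def fortune : History V → ℝ
  | [] => 1
  | r :: h =>
    if r.guess = r.choice then
      (if outDeg G r.node = 1 then fortune h + r.wager * fortune h
        else fortune h + ((outDeg G r.node : ℝ) - 1) * (r.wager * fortune h))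
    else fortune h - r.wager * fortune h

variable {G}

/-- One round of play from a given history and current vertex. The guess and the choice are drawn
independently given the history and the wager. At a terminal node nothing more happens. -/
noncomputable def step (σ : ChooserStrategy G) (τ : GuesserStrategy G) (s : History V × V) :
    PMF (History V × V) :=
  if IsTerminal G s.2 then PMF.pure s
  else
    (τ.guess s.1 s.2).bind fun g =>
      (σ.choose s.1 s.2 (τ.wager s.1 s.2)).bind fun j =>
        PMF.pure ((⟨s.2, τ.wager s.1 s.2, g, j⟩ : Round V) :: s.1, j)

/-- The joint law of the history and of the position `X_t` at time `t`, when play starts at `i`. -/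
noncomputable def law (σ : ChooserStrategy G) (τ : GuesserStrategy G) (i : V) :
    ℕ → PMF (History V × V)
  | 0 => PMF.pure ([], i)
  | t + 1 => (law σ τ i t).bind (step σ τ)

/-- The expectation of a nonnegative function under a discrete law. -/
noncomputable def expect {α : Type*} (p : PMF α) (f : α → ℝ≥0∞) : ℝ≥0∞ := ∑' a, p a * f a

/-- `P(T ≤ t)`, where `T` is the hitting time of the set of terminal nodes. -/
noncomputable def endProb (σ : ChooserStrategy G) (τ : GuesserStrategy G) (i : V) (t : ℕ) : ℝ≥0∞ :=
  expect (law σ τ i t) fun s => if IsTerminal G s.2 then 1 else 0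

/-- `P(T < ∞) = 1`: the game ends almost surely. -/
def EndsAS (σ : ChooserStrategy G) (τ : GuesserStrategy G) (i : V) : Prop :=
  Tendsto (endProb σ τ i) atTop (𝓝 1)

/-- `E[F_t]`, where `F_t` is the Guesser's fortune at time `t` (multiplied by the terminal value if
the game has ended by then). -/
noncomputable def expFortune (val : V → ℝ) (σ : ChooserStrategy G) (τ : GuesserStrategy G)
    (i : V) (t : ℕ) : ℝ≥0∞ :=
  expect (law σ τ i t) fun s =>
    ENNReal.ofReal (if IsTerminal G s.2 then fortune G s.1 * val s.2 else fortune G s.1)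

/-- `E[F_T ; T < ∞]`, the expected fortune at the end of the game, written as the increasing limit
of `E[F_T ; T ≤ t]` (play is frozen from time `T` on). It is `E[F_T]` if the game ends almost
surely. -/
noncomputable def finalFortune (val : V → ℝ) (σ : ChooserStrategy G) (τ : GuesserStrategy G)
    (i : V) : ℝ≥0∞ :=
  ⨆ t, expect (law σ τ i t) fun s =>
    if IsTerminal G s.2 then ENNReal.ofReal (fortune G s.1 * val s.2) else 0

open Classical in
/-- The payoff of a pair of strategies: the expected fortune at the end of the game if the game
ends almost surely, and otherwise the upper limit of the expected fortunes `E[F_t]`. -/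
noncomputable def payoff (val : V → ℝ) (σ : ChooserStrategy G) (τ : GuesserStrategy G)
    (i : V) : ℝ≥0∞ :=
  if EndsAS σ τ i then finalFortune val σ τ i else limsup (expFortune val σ τ i) atTop

/-- The Chooser plays the same mixture at every visit to a vertex. -/
def ChooserStrategy.IsPositional (σ : ChooserStrategy G) : Prop :=
  ∀ h h' i w w', ¬ IsTerminal G i → σ.choose h i w = σ.choose h' i w'

/-- The part of a history that is not concerned with the Guesser's guesses: the vertices
visited, the wagers and the choices. -/
def publicPart (h : History V) : List (V × ℝ × V) := h.map fun r => (r.node, r.wager, r.choice)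

/-- The Chooser's choices do not depend on what the Guesser guessed in earlier rounds. -/
def ChooserStrategy.IsGuessBlind (σ : ChooserStrategy G) : Prop :=
  ∀ h h' i w, ¬ IsTerminal G i → publicPart h = publicPart h' →
    σ.choose h i w = σ.choose h' i w

/-- For play from `i`, no strategy of the Chooser has a smaller worst-case payoff than `σ`. -/
def ChooserOptimal (val : V → ℝ) (σ : ChooserStrategy G) (i : V) : Prop :=
  ∀ σ' : ChooserStrategy G, ⨆ τ, payoff val σ τ i ≤ ⨆ τ, payoff val σ' τ i

/-- The expected final fortune that `τ` secures from `i` against every guess-blind Chooser against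
whom the game ends almost surely. -/
noncomputable def guarantee (val : V → ℝ) (τ : GuesserStrategy G) (i : V) : ℝ≥0∞ :=
  ⨅ (σ : ChooserStrategy G) (_ : σ.IsGuessBlind) (_ : EndsAS σ τ i), finalFortune val σ τ i

/-- For play from `i`, no strategy of the Guesser secures more than `τ`. -/
def GuesserOptimal (val : V → ℝ) (τ : GuesserStrategy G) (i : V) : Prop :=
  ∀ τ' : GuesserStrategy G, guarantee val τ' i ≤ guarantee val τ i

/-- The Chooser's limiting strategy for the reciprocal values `u`. -/
def IsLimitingChooser (u : V → ℝ) (σ : ChooserStrategy G) : Prop :=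
  ∀ h i w j, ¬ IsTerminal G i → σ.choose h i w j = ENNReal.ofReal (chooserProb G u i j)

/-- The Guesser's limiting strategies with parameter `β` for the reciprocal values `u`. If the
prescribed wager `1 - n_i β p_{i,min}` is zero, then the formula for the guess has the form `0 / 0`,
the guess has no effect, and it is left arbitrary. -/
def IsLimitingGuesser (u : V → ℝ) (β : ℝ) (τ : GuesserStrategy G) : Prop :=
  ∀ h i,
    (outDeg G i = 1 → τ.wager h i = 1 ∧ ∀ j, G.Adj i j → τ.guess h i j = 1) ∧
    (2 ≤ outDeg G i →
      τ.wager h i = 1 - (outDeg G i : ℝ) * β * chooserProbMin G u i ∧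
      (1 - (outDeg G i : ℝ) * β * chooserProbMin G u i ≠ 0 → ∀ j, G.Adj i j →
        τ.guess h i j = ENNReal.ofReal
          ((chooserProb G u i j - β * chooserProbMin G u i) /
            (1 - (outDeg G i : ℝ) * β * chooserProbMin G u i))))

end Game

end PathGuessing

/-!
Write `m_i` for the odds at a non-terminal vertex: `2` if there is one successor, and `n_i`
otherwise. A round with wager `w`, guess `g` and choice `j` multiplies the fortune by `1 - w`, plus
`m_i w` if `g = j`, and `M` averages over the successors with weight `1 / m_i`. Everything rests on
the identity `p_{i,j} = u_j / (m_i u_i)` (`chooserProb_eq`) for the positive fixed vector `u` of `M`.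

*The limit.* The iterates of `M` on a nonnegative vector that vanishes off the terminal vertices
increase, those on the indicator function of the non-terminal vertices decrease, and both stay
bounded. By the maximum principle (`nonpos_of_fixed`) the latter tend to zero, so the values of the initial vector
at non-terminal vertices do not matter (`exists_limit`).

*The limiting Chooser.* Against him `F_t / u (X_t)` is a supermartingale
(`expect_step_limitingChooser_le`), and the probability that play lasts beyond time `t` is
`(M ^ t y) i / u i`, where `y` is `u` with zeros put at the terminal vertices
(`endsAS_limitingChooser`).

*The limiting Guesser.* Whatever successor `j` is chosen, her guess multiplies the expected fortune
by `u_j / u_i`. Against a guess-blind Chooser the conditional expectation of `F_t` given the public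
part of the play is therefore `u (X_t) / u i` (`expect_law_limitingGuesser`), and
`E[F_T; T ≤ t] = P(T ≤ t) / u i`.

*Arbitrary Choosers.* The limiting Guesser need not secure `1 / u i` against a Chooser who reacts to
the guesses, or who does not let the game end. Optimality of the limiting Chooser needs only some
Guesser strategy for each Chooser, which may use his transition probabilities. For a horizon `K` and
a positive vector `y`, the greedy Guesser wagers everything on a successor `j` maximizing
`q_j / (M ^ k y) j`, where `q` is the current mixture of the Chooser and `k` the number of rounds that
remain after the current one; after `K` rounds she never wagers again. Averaging over the successors
with weights `(M ^ k y) j` shows that her payoff is at least `1 / (M ^ K y) i`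
(`exists_le_payoff_mul`), if `1 / y` is at most the value of a fortune of one at the end of the
horizon. As `M ^ K y` tends to `u`, the supremum of the payoffs is at least `1 / u i`
(`le_iSup_payoff`). With the survival probabilities of a positional Chooser in the numerator, `y` may
be arbitrarily small at the terminal vertices; so if such a Chooser avoids the end of the game with
positive probability, the payoffs are unbounded (`endsAS_of_iSup_payoff_ne_top`).
-/

namespace PathGuessing

/-! ### The propagation matrix and its fixed vector -/

section PropagationMatrix

variable {V : Type*} [Fintype V] {G : Digraph V} [DecidableRel G.Adj]

variable (G) in
/-- The successors of a vertex, as a finite set. -/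
def succs (i : V) : Finset V := Finset.univ.filter fun j => G.Adj i j

variable (G) in
/-- The odds `m_i` paid at a vertex: `2` if there is one successor, and `n_i` otherwise. A nonzero
entry of the propagation matrix in a non-terminal row `i` is `1 / m_i`, and a round with wager `w`
multiplies the fortune by `1 - w`, plus `m_i * w` if the guess is correct. -/
noncomputable def odds (i : V) : ℝ := if outDeg G i = 1 then 2 else outDeg G i

variable (G) in
/-- The indicator function of the non-terminal vertices. -/
def nonterminalInd (i : V) : ℝ := if IsTerminal G i then 0 else 1

@[simp] lemma mem_succs {i j : V} : j ∈ succs G i ↔ G.Adj i j := by simp [succs]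

lemma card_succs (i : V) : (succs G i).card = outDeg G i := rfl

lemma not_isTerminal_of_adj {i j : V} (h : G.Adj i j) : ¬ IsTerminal G i := by
  intro h0
  have : j ∈ succs G i := mem_succs.2 h
  rw [Finset.card_eq_zero.1 (show (succs G i).card = 0 from h0)] at this
  simp at this

lemma exists_adj {i : V} (h : ¬ IsTerminal G i) : ∃ j, G.Adj i j := by
  have : (succs G i).Nonempty := Finset.card_ne_zero.1 h
  obtain ⟨j, hj⟩ := this
  exact ⟨j, mem_succs.1 hj⟩

lemma odds_pos {i : V} (h : ¬ IsTerminal G i) : 0 < odds G i := by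
  unfold odds
  split_ifs
  · norm_num
  · exact_mod_cast Nat.pos_of_ne_zero h

lemma outDeg_le_odds (i : V) : (outDeg G i : ℝ) ≤ odds G i := by
  unfold odds
  split_ifs with h
  · rw [h]; norm_num
  · exact le_rfl

lemma nonterminalInd_nonneg : 0 ≤ nonterminalInd G := by
  intro i
  simp only [nonterminalInd, Pi.zero_apply]
  split_ifs <;> norm_num

variable [DecidableEq V]

lemma propMatrix_mulVec_of_isTerminal {i : V} (h : IsTerminal G i) (x : V → ℝ) :
    (propMatrix G *ᵥ x) i = x i := by
  simp [Matrix.mulVec, dotProduct, propMatrix, h]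

lemma propMatrix_mulVec {i : V} (h : ¬ IsTerminal G i) (x : V → ℝ) :
    (propMatrix G *ᵥ x) i = (∑ j ∈ succs G i, x j) / odds G i := by
  rw [Finset.sum_div]
  simp only [Matrix.mulVec, dotProduct, propMatrix, h, if_false, succs, Finset.sum_filter, odds]
  refine Finset.sum_congr rfl fun j _ => ?_
  split_ifs <;> ring

lemma propMatrix_pow_succ_mulVec (s : ℕ) (x : V → ℝ) :
    propMatrix G ^ (s + 1) *ᵥ x = propMatrix G *ᵥ (propMatrix G ^ s *ᵥ x) := by
  rw [pow_succ', Matrix.mulVec_mulVec]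

lemma propMatrix_mulVec_mono {x y : V → ℝ} (h : x ≤ y) :
    propMatrix G *ᵥ x ≤ propMatrix G *ᵥ y := by
  intro i
  by_cases hi : IsTerminal G i
  · simpa [propMatrix_mulVec_of_isTerminal hi] using h i
  · rw [propMatrix_mulVec hi, propMatrix_mulVec hi]
    have := (odds_pos hi).le
    gcongr with j
    exact h j

lemma propMatrix_pow_mulVec_mono (s : ℕ) {x y : V → ℝ} (h : x ≤ y) :
    propMatrix G ^ s *ᵥ x ≤ propMatrix G ^ s *ᵥ y := by
  induction s with
  | zero => simpa using h
  | succ s ih =>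
    rw [propMatrix_pow_succ_mulVec, propMatrix_pow_succ_mulVec]
    exact propMatrix_mulVec_mono ih

lemma propMatrix_pow_mulVec_of_isTerminal (s : ℕ) {i : V} (h : IsTerminal G i) (x : V → ℝ) :
    (propMatrix G ^ s *ᵥ x) i = x i := by
  induction s with
  | zero => simp
  | succ s ih => rw [propMatrix_pow_succ_mulVec, propMatrix_mulVec_of_isTerminal h, ih]

/-- A constant `C ≥ 0` does not increase under the propagation matrix, whose rows have sum at
most one. -/
lemma propMatrix_mulVec_const_le {C : ℝ} (hC : 0 ≤ C) :
    propMatrix G *ᵥ (fun _ => C) ≤ fun _ => C := by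
  intro i
  by_cases hi : IsTerminal G i
  · simp [propMatrix_mulVec_of_isTerminal hi]
  · rw [propMatrix_mulVec hi, Finset.sum_const, nsmul_eq_mul, card_succs,
      div_le_iff₀ (odds_pos hi), mul_comm]
    exact mul_le_mul_of_nonneg_left (outDeg_le_odds i) hC

lemma propMatrix_pow_mulVec_const_le {C : ℝ} (hC : 0 ≤ C) (s : ℕ) :
    propMatrix G ^ s *ᵥ (fun _ => C) ≤ fun _ => C := by
  induction s with
  | zero => simp
  | succ s ih =>
    rw [propMatrix_pow_succ_mulVec]
    exact (propMatrix_mulVec_mono ih).trans (propMatrix_mulVec_const_le hC)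

lemma propMatrix_pow_mulVec_nonneg (s : ℕ) {x : V → ℝ} (h : 0 ≤ x) :
    0 ≤ propMatrix G ^ s *ᵥ x := by
  simpa using propMatrix_pow_mulVec_mono (G := G) s h

/-- Positivity is preserved, since no row vanishes. -/
lemma propMatrix_pow_mulVec_pos (s : ℕ) {x : V → ℝ} (h : ∀ i, 0 < x i) (i : V) :
    0 < (propMatrix G ^ s *ᵥ x) i := by
  induction s generalizing i with
  | zero => simpa using h i
  | succ s ih =>
    rw [propMatrix_pow_succ_mulVec]
    by_cases hi : IsTerminal G i
    · rw [propMatrix_mulVec_of_isTerminal hi]; exact ih i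
    · rw [propMatrix_mulVec hi]
      obtain ⟨j, hj⟩ := exists_adj hi
      exact div_pos (Finset.sum_pos (fun j _ => ih j) ⟨j, mem_succs.2 hj⟩) (odds_pos hi)

/-- The maximum principle: a positive maximum of a fixed vector would propagate along a path to a
terminal vertex. -/
lemma nonpos_of_fixed (hG : IsTerminating G) {x : V → ℝ} (hx : propMatrix G *ᵥ x = x)
    (h0 : ∀ k, IsTerminal G k → x k = 0) (i : V) : x i ≤ 0 := by
  have : Nonempty V := ⟨i⟩
  obtain ⟨a, ha⟩ := Finite.exists_max x
  refine (ha i).trans ?_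
  by_contra! hpos
  obtain ⟨k, hk, hpath⟩ := hG a
  have key : x k = x a := by
    clear hk
    induction hpath with
    | refl => rfl
    | @tail b c _ hbc ih =>
      have hb := not_isTerminal_of_adj hbc
      have hxb := congrFun hx b
      rw [propMatrix_mulVec hb, div_eq_iff (odds_pos hb).ne'] at hxb
      -- the sum of the successor values is at most `n_b * x a`, and equals `m_b * x a`
      have hle : ∑ j ∈ succs G b, x a ≤ ∑ j ∈ succs G b, x j := by
        rw [hxb, ih, Finset.sum_const, nsmul_eq_mul, card_succs, mul_comm]
        exact mul_le_mul_of_nonneg_left (outDeg_le_odds b) hpos.le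
      have heq := le_antisymm hle (Finset.sum_le_sum fun j _ => ha j)
      have := (Finset.sum_eq_sum_iff_of_le fun j (_ : j ∈ succs G b) => ha j).1 heq.symm
      exact this c (mem_succs.2 hbc)
  rw [h0 k hk] at key
  exact hpos.ne key

lemma eq_zero_of_fixed (hG : IsTerminating G) {x : V → ℝ} (hx : propMatrix G *ᵥ x = x)
    (h0 : ∀ k, IsTerminal G k → x k = 0) : x = 0 := by
  funext i
  refine le_antisymm (nonpos_of_fixed hG hx h0 i) ?_
  have := nonpos_of_fixed (x := -x) hG (by rw [Matrix.mulVec_neg, hx])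
    (fun k hk => by simp [h0 k hk]) i
  simpa using this

lemma mulVec_eq_of_tendsto {x u : V → ℝ}
    (h : Tendsto (fun s : ℕ => propMatrix G ^ s *ᵥ x) atTop (𝓝 u)) : propMatrix G *ᵥ u = u := by
  have h1 := (tendsto_add_atTop_iff_nat 1).2 h
  have h2 : Tendsto (fun s : ℕ => propMatrix G *ᵥ (propMatrix G ^ s *ᵥ x)) atTop
      (𝓝 (propMatrix G *ᵥ u)) :=
    ((Continuous.matrix_mulVec continuous_const continuous_id).tendsto u).comp h
  simp only [propMatrix_pow_succ_mulVec] at h1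
  exact tendsto_nhds_unique h2 h1

/-- The iterates decrease pointwise, and their limit is a fixed vector that vanishes at the terminal
vertices. -/
lemma tendsto_pow_mulVec_nonterminalInd (hG : IsTerminating G) :
    Tendsto (fun s : ℕ => propMatrix G ^ s *ᵥ nonterminalInd G) atTop (𝓝 0) := by
  have hstep : propMatrix G *ᵥ nonterminalInd G ≤ nonterminalInd G := by
    intro i
    by_cases hi : IsTerminal G i
    · rw [propMatrix_mulVec_of_isTerminal hi]
    · have h1 : nonterminalInd G ≤ fun _ => (1 : ℝ) := by
        intro j; simp only [nonterminalInd]; split_ifs <;> norm_num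
      have := ((propMatrix_mulVec_mono (G := G) h1).trans
        (propMatrix_mulVec_const_le zero_le_one)) i
      simpa [nonterminalInd, hi] using this
  have hanti : Antitone fun s : ℕ => propMatrix G ^ s *ᵥ nonterminalInd G := by
    refine antitone_nat_of_succ_le fun s => ?_
    rw [pow_succ, ← Matrix.mulVec_mulVec]
    exact propMatrix_pow_mulVec_mono s hstep
  have hlim : ∀ i, ∃ a, Tendsto (fun s : ℕ => (propMatrix G ^ s *ᵥ nonterminalInd G) i) atTop
      (𝓝 a) := fun i =>
    ⟨_, tendsto_atTop_ciInf (fun s t hst => hanti hst i)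
      ⟨0, by
        rintro _ ⟨s, rfl⟩
        exact propMatrix_pow_mulVec_nonneg s nonterminalInd_nonneg i⟩⟩
  choose a ha using hlim
  have ha' := tendsto_pi_nhds.2 ha
  rwa [eq_zero_of_fixed hG (mulVec_eq_of_tendsto ha') fun k hk => ?_] at ha'
  refine tendsto_nhds_unique (ha k) ?_
  simp [propMatrix_pow_mulVec_of_isTerminal _ hk, nonterminalInd, hk]

lemma tendsto_pow_mulVec_zero (hG : IsTerminating G) {y : V → ℝ}
    (hy : ∀ k, IsTerminal G k → y k = 0) :
    Tendsto (fun s : ℕ => propMatrix G ^ s *ᵥ y) atTop (𝓝 0) := by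
  set C := ∑ j, |y j| with hC
  have hbound : ∀ i, |y i| ≤ (C • nonterminalInd G) i := by
    intro i
    by_cases hi : IsTerminal G i
    · simp [hy i hi, nonterminalInd, hi]
    · simp only [Pi.smul_apply, nonterminalInd, hi, if_false, smul_eq_mul, mul_one]
      exact Finset.single_le_sum (f := fun j => |y j|) (fun j _ => abs_nonneg _)
        (Finset.mem_univ i)
  have hz := (tendsto_pow_mulVec_nonterminalInd hG).const_smul C
  rw [smul_zero] at hz
  have hz' : Tendsto (fun s : ℕ => propMatrix G ^ s *ᵥ (C • nonterminalInd G)) atTop (𝓝 0) := by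
    simpa only [Matrix.mulVec_smul] using hz
  have hn : Tendsto (fun s : ℕ => propMatrix G ^ s *ᵥ (-(C • nonterminalInd G))) atTop (𝓝 0) := by
    simpa only [Matrix.mulVec_neg, neg_zero] using hz'.neg
  rw [tendsto_pi_nhds] at hn hz' ⊢
  exact fun j => tendsto_of_tendsto_of_tendsto_of_le_of_le (hn j) (hz' j)
    (fun s => propMatrix_pow_mulVec_mono s (fun i => (abs_le.1 (hbound i)).1) j)
    (fun s => propMatrix_pow_mulVec_mono s (fun i => (abs_le.1 (hbound i)).2) j)

/-- Started from the reciprocal values at the terminal vertices and zero elsewhere, the iterates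
increase and are bounded; the values at the other vertices do not affect the limit. -/
lemma exists_limit (hG : IsTerminating G) {val : V → ℝ}
    (hval : ∀ k, IsTerminal G k → 0 < val k) :
    ∃ u : V → ℝ, (∀ i, 0 < u i) ∧ propMatrix G *ᵥ u = u ∧
      (∀ k, IsTerminal G k → u k = (val k)⁻¹) ∧
      ∀ y : V → ℝ, (∀ k, IsTerminal G k → y k = (val k)⁻¹) →
        Tendsto (fun s : ℕ => propMatrix G ^ s *ᵥ y) atTop (𝓝 u) := by
  set b : V → ℝ := fun i => if IsTerminal G i then (val i)⁻¹ else 0 with hb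
  have hb0 : 0 ≤ b := by
    intro i
    simp only [hb, Pi.zero_apply]
    split_ifs with h
    · exact (inv_pos.2 (hval i h)).le
    · exact le_rfl
  have hstep : b ≤ propMatrix G *ᵥ b := by
    intro i
    by_cases hi : IsTerminal G i
    · rw [propMatrix_mulVec_of_isTerminal hi]
    · have := propMatrix_pow_mulVec_nonneg (G := G) 1 hb0 i
      simpa [hb, hi] using this
  have hmono : Monotone fun s : ℕ => propMatrix G ^ s *ᵥ b := by
    refine monotone_nat_of_le_succ fun s => ?_
    rw [pow_succ, ← Matrix.mulVec_mulVec]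
    exact propMatrix_pow_mulVec_mono s hstep
  have hbC : b ≤ fun _ => ∑ j, b j := fun i =>
    Finset.single_le_sum (f := b) (fun j _ => hb0 j) (Finset.mem_univ i)
  have hlim : ∀ i, ∃ a, Tendsto (fun s : ℕ => (propMatrix G ^ s *ᵥ b) i) atTop (𝓝 a) := fun i =>
    ⟨_, tendsto_atTop_ciSup (fun s t hst => hmono hst i)
      ⟨∑ j, b j, by
        rintro _ ⟨s, rfl⟩
        exact ((propMatrix_pow_mulVec_mono s hbC).trans
          (propMatrix_pow_mulVec_const_le (Finset.sum_nonneg fun j _ => hb0 j) s)) i⟩⟩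
  choose u hu using hlim
  have hu' := tendsto_pi_nhds.2 hu
  have hfix := mulVec_eq_of_tendsto hu'
  have huT : ∀ k, IsTerminal G k → u k = (val k)⁻¹ := fun k hk =>
    tendsto_nhds_unique (hu k) (by simp [propMatrix_pow_mulVec_of_isTerminal _ hk, hb, hk])
  have hu0 : ∀ i, 0 ≤ u i := fun i =>
    ge_of_tendsto' (hu i) fun s => propMatrix_pow_mulVec_nonneg s hb0 i
  refine ⟨u, fun i => ?_, hfix, huT, fun y hy => ?_⟩
  · obtain ⟨k, hk, hpath⟩ := hG i
    induction hpath using Relation.ReflTransGen.head_induction_on with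
    | refl => rw [huT k hk]; exact inv_pos.2 (hval k hk)
    | @head a c hac _ ih =>
      have ha := not_isTerminal_of_adj hac
      rw [← hfix, propMatrix_mulVec ha]
      exact div_pos (Finset.sum_pos' (fun j _ => hu0 j) ⟨c, mem_succs.2 hac, ih⟩) (odds_pos ha)
  · have h1 := hu'.add (tendsto_pow_mulVec_zero hG (y := y - b)
      fun k hk => by simp [hb, hk, hy k hk])
    simpa [← Matrix.mulVec_add] using h1

end PropagationMatrix

/-! ### Expectations and the law of the play -/

section Expectation

variable {α β : Type*}

lemma expect_pure (a : α) (f : α → ℝ≥0∞) : expect (PMF.pure a) f = f a := by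
  classical
  rw [expect, tsum_eq_single a]
  · simp
  · intro b hb; simp [PMF.pure_apply, hb]

lemma expect_bind (p : PMF α) (q : α → PMF β) (f : β → ℝ≥0∞) :
    expect (p.bind q) f = expect p fun a => expect (q a) f := by
  simp only [expect, PMF.bind_apply, ← ENNReal.tsum_mul_right, ← ENNReal.tsum_mul_left]
  rw [ENNReal.tsum_comm]
  simp only [mul_assoc]

lemma expect_mono_of_support {p : PMF α} {f g : α → ℝ≥0∞} (h : ∀ a ∈ p.support, f a ≤ g a) :
    expect p f ≤ expect p g := by
  refine ENNReal.tsum_le_tsum fun a => ?_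
  by_cases ha : p a = 0
  · simp [ha]
  · exact mul_le_mul_right (h a ((PMF.mem_support_iff _ _).2 ha)) _

lemma expect_mono {p : PMF α} {f g : α → ℝ≥0∞} (h : ∀ a, f a ≤ g a) :
    expect p f ≤ expect p g :=
  expect_mono_of_support fun a _ => h a

lemma expect_const_mul (p : PMF α) (c : ℝ≥0∞) (f : α → ℝ≥0∞) :
    expect p (fun a => c * f a) = c * expect p f := by
  simp only [expect, ← ENNReal.tsum_mul_left, mul_left_comm]

lemma expect_add (p : PMF α) (f g : α → ℝ≥0∞) :
    expect p (fun a => f a + g a) = expect p f + expect p g := by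
  simp only [expect, mul_add, ENNReal.tsum_add]

lemma expect_one (p : PMF α) : expect p (fun _ => 1) = 1 := by
  simp [expect, p.tsum_coe]

end Expectation

section Play

variable {V : Type*} [Fintype V] {G : Digraph V} [DecidableRel G.Adj]

lemma sum_pmf (p : PMF V) : ∑ j, p j = 1 := by
  rw [← tsum_fintype (L := .unconditional _), p.tsum_coe]

lemma odds_nonneg (i : V) : 0 ≤ odds G i := by
  unfold odds; split_ifs <;> positivity

variable (σ : ChooserStrategy G) (τ : GuesserStrategy G)

lemma expect_step_of_isTerminal {h : History V} {i : V} (hi : IsTerminal G i)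
    (f : History V × V → ℝ≥0∞) : expect (step σ τ (h, i)) f = f (h, i) := by
  rw [step, if_pos hi, expect_pure]

lemma expect_step {h : History V} {i : V} (hi : ¬ IsTerminal G i) (f : History V × V → ℝ≥0∞) :
    expect (step σ τ (h, i)) f = ∑ g, τ.guess h i g *
      ∑ j, σ.choose h i (τ.wager h i) j * f (⟨i, τ.wager h i, g, j⟩ :: h, j) := by
  rw [step, if_neg hi]
  simp only [expect_bind, expect_pure]
  simp only [expect, tsum_fintype]

lemma expect_law_succ (i : V) (t : ℕ) (f : History V × V → ℝ≥0∞) :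
    expect (law σ τ i (t + 1)) f = expect (law σ τ i t) fun s => expect (step σ τ s) f := by
  rw [law, expect_bind]

lemma expect_law_zero (i : V) (f : History V × V → ℝ≥0∞) :
    expect (law σ τ i 0) f = f ([], i) := by
  rw [law, expect_pure]

variable {σ τ}

/-- The expectation of a submartingale is nondecreasing. -/
lemma monotone_expect_law {f : History V × V → ℝ≥0∞} (hf : ∀ s, f s ≤ expect (step σ τ s) f)
    (i : V) : Monotone fun t => expect (law σ τ i t) f :=
  monotone_nat_of_le_succ fun t => by
    rw [expect_law_succ]; exact expect_mono hf

/-- The expectation of a supermartingale is nonincreasing. -/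
lemma antitone_expect_law {f : History V × V → ℝ≥0∞} (hf : ∀ s, expect (step σ τ s) f ≤ f s)
    (i : V) : Antitone fun t => expect (law σ τ i t) f :=
  antitone_nat_of_succ_le fun t => by
    rw [expect_law_succ]; exact expect_mono hf

/-- A property of the time and the state that holds at the start and is preserved by rounds holds
at all times with probability one. -/
lemma law_support_induction {i : V} (P : ℕ → History V × V → Prop) (h0 : P 0 ([], i))
    (hT : ∀ t h k, IsTerminal G k → P t (h, k) → P (t + 1) (h, k))
    (hN : ∀ t h k g j, ¬ IsTerminal G k → P t (h, k) →
      P (t + 1) (⟨k, τ.wager h k, g, j⟩ :: h, j))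
    (t : ℕ) : ∀ s ∈ (law σ τ i t).support, P t s := by
  induction t with
  | zero =>
    intro s hs
    simp only [law, PMF.support_pure, Set.mem_singleton_iff] at hs
    rwa [hs]
  | succ t ih =>
    intro s hs
    rw [law, PMF.mem_support_bind_iff] at hs
    obtain ⟨⟨h, k⟩, hmem, hs⟩ := hs
    by_cases hk : IsTerminal G k
    · rw [step, if_pos hk, PMF.support_pure, Set.mem_singleton_iff] at hs
      rw [hs]; exact hT t h k hk (ih _ hmem)
    · rw [step, if_neg hk] at hs
      simp only [PMF.mem_support_bind_iff, PMF.support_pure, Set.mem_singleton_iff] at hs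
      obtain ⟨g, -, j, -, rfl⟩ := hs
      exact hN t h k g j hk (ih _ hmem)

lemma le_expect_step_of_eq_zero {f : V → ℝ≥0∞} (hf0 : ∀ i, ¬ IsTerminal G i → f i = 0)
    (s : History V × V) : f s.2 ≤ expect (step σ τ s) fun s => f s.2 := by
  obtain ⟨h, i⟩ := s
  by_cases hi : IsTerminal G i
  · rw [expect_step_of_isTerminal σ τ hi]
  · simp [hf0 i hi]

lemma monotone_endProb (i : V) : Monotone (endProb σ τ i) :=
  monotone_expect_law (f := fun s => if IsTerminal G s.2 then 1 else 0)
    (le_expect_step_of_eq_zero (f := fun j => if IsTerminal G j then 1 else 0)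
      fun i hi => by simp [hi]) i

lemma endsAS_iff_iSup {i : V} : EndsAS σ τ i ↔ ⨆ t, endProb σ τ i t = 1 :=
  ⟨fun h => tendsto_nhds_unique (tendsto_atTop_iSup (monotone_endProb i)) h,
    fun h => by
      have := tendsto_atTop_iSup (monotone_endProb (σ := σ) (τ := τ) i)
      rwa [h] at this⟩

/-- The probability that the game has not ended by time `t`. -/
noncomputable def survival (σ : ChooserStrategy G) (τ : GuesserStrategy G) (i : V) (t : ℕ) :
    ℝ≥0∞ :=
  expect (law σ τ i t) fun s => if IsTerminal G s.2 then 0 else 1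

lemma endProb_add_survival (i : V) (t : ℕ) : endProb σ τ i t + survival σ τ i t = 1 := by
  rw [endProb, survival, ← expect_add]
  refine Eq.trans ?_ (expect_one (law σ τ i t))
  congr 1
  funext s
  split_ifs <;> simp

lemma survival_eq (i : V) (t : ℕ) : survival σ τ i t = 1 - endProb σ τ i t := by
  have h := endProb_add_survival (σ := σ) (τ := τ) i t
  refine ENNReal.eq_sub_of_add_eq ?_ (by rw [add_comm]; exact h)
  exact ne_top_of_le_ne_top ENNReal.one_ne_top (h ▸ le_self_add)

lemma endProb_eq (i : V) (t : ℕ) : endProb σ τ i t = 1 - survival σ τ i t := by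
  have h := endProb_add_survival (σ := σ) (τ := τ) i t
  refine ENNReal.eq_sub_of_add_eq ?_ h
  exact ne_top_of_le_ne_top ENNReal.one_ne_top (h ▸ le_add_self)

lemma endsAS_iff_survival {i : V} :
    EndsAS σ τ i ↔ Tendsto (survival σ τ i) atTop (𝓝 0) := by
  constructor
  · intro h
    have := ENNReal.Tendsto.sub (tendsto_const_nhds (x := (1 : ℝ≥0∞))) h
      (Or.inl ENNReal.one_ne_top)
    rw [tsub_self] at this
    exact this.congr fun t => (survival_eq i t).symm
  · intro h
    have := ENNReal.Tendsto.sub (tendsto_const_nhds (x := (1 : ℝ≥0∞))) h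
      (Or.inl ENNReal.one_ne_top)
    rw [tsub_zero] at this
    exact this.congr fun t => (endProb_eq i t).symm

/-- The law of the position under transition probabilities that depend on the vertex only: if `x`
is obtained by iterating them, then `x t` is the expectation of `x 0` at time `t`. -/
lemma expect_law_eq_iterate {x : ℕ → V → ℝ≥0∞}
    (hT : ∀ k i, IsTerminal G i → x (k + 1) i = x k i)
    (hN : ∀ k h i w, ¬ IsTerminal G i → x (k + 1) i = ∑ j, σ.choose h i w j * x k j)
    (i : V) (t k : ℕ) : expect (law σ τ i t) (fun s => x k s.2) = x (t + k) i := by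
  induction t generalizing k with
  | zero => simp [expect_law_zero]
  | succ t ih =>
    rw [expect_law_succ, add_right_comm, add_assoc, ← ih (k + 1)]
    congr 1
    funext ⟨h, l⟩
    by_cases hl : IsTerminal G l
    · rw [expect_step_of_isTerminal _ _ hl, hT k l hl]
    · rw [expect_step _ _ hl]
      simp only [← hN k h l _ hl, ← Finset.sum_mul, sum_pmf, one_mul]

variable [DecidableEq V]

variable (G) in
/-- The factor by which the fortune is multiplied in a round at `i` with wager `w`, guess `g` and
choice `j`. -/
noncomputable def roundFactor (i : V) (w : ℝ) (g j : V) : ℝ :=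
  1 - w + if g = j then odds G i * w else 0

lemma fortune_cons (i : V) (w : ℝ) (g j : V) (h : History V) :
    fortune G (⟨i, w, g, j⟩ :: h) = roundFactor G i w g j * fortune G h := by
  simp only [fortune, roundFactor, odds]
  split_ifs <;> ring

lemma roundFactor_nonneg {w : ℝ} (h0 : 0 ≤ w) (h1 : w ≤ 1) (i g j : V) :
    0 ≤ roundFactor G i w g j := by
  have := odds_nonneg (G := G) i
  unfold roundFactor
  have : 0 ≤ if g = j then odds G i * w else 0 := by split_ifs <;> positivity
  linarith

lemma ofReal_fortune_cons {w : ℝ} (h0 : 0 ≤ w) (h1 : w ≤ 1) (i g j : V) (h : History V) :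
    ENNReal.ofReal (fortune G (⟨i, w, g, j⟩ :: h)) =
      ENNReal.ofReal (roundFactor G i w g j) * ENNReal.ofReal (fortune G h) := by
  rw [fortune_cons, ENNReal.ofReal_mul (roundFactor_nonneg h0 h1 i g j)]

lemma finalFortune_le_limsup (val : V → ℝ) (i : V) :
    finalFortune val σ τ i ≤ limsup (expFortune val σ τ i) atTop := by
  have hmono : Monotone fun t => expect (law σ τ i t) fun s =>
      if IsTerminal G s.2 then ENNReal.ofReal (fortune G s.1 * val s.2) else 0 := by
    refine monotone_expect_law (fun s => ?_) i
    obtain ⟨h, i⟩ := s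
    by_cases hi : IsTerminal G i
    · rw [expect_step_of_isTerminal _ _ hi]
    · simp [hi]
  rw [finalFortune, ← (tendsto_atTop_iSup hmono).limsup_eq]
  refine limsup_le_limsup (Eventually.of_forall fun t => expect_mono fun s => ?_)
  split_ifs <;> simp

lemma finalFortune_le_payoff (val : V → ℝ) (i : V) :
    finalFortune val σ τ i ≤ payoff val σ τ i := by
  unfold payoff
  split_ifs
  · exact le_rfl
  · exact finalFortune_le_limsup val i

end Play

/-! ### The limiting strategies -/

section LimitingStrategies

variable {V : Type*} [Fintype V] {G : Digraph V} [DecidableRel G.Adj]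

lemma exists_pmf {p : V → ℝ} (h0 : ∀ j, 0 ≤ p j) (h1 : ∑ j, p j = 1) :
    ∃ q : PMF V, ∀ j, q j = ENNReal.ofReal (p j) :=
  ⟨PMF.ofFintype (fun j => ENNReal.ofReal (p j)) (by
    rw [← ENNReal.ofReal_sum_of_nonneg fun j _ => h0 j, h1, ENNReal.ofReal_one]), fun _ => rfl⟩

lemma sum_eq_sum_succs {M : Type*} [AddCommMonoid M] {i : V} {f : V → M}
    (hf : ∀ j, ¬ G.Adj i j → f j = 0) : ∑ j, f j = ∑ j ∈ succs G i, f j :=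
  (Finset.sum_subset (Finset.subset_univ _) fun j _ hj =>
    hf j fun h => hj (mem_succs.2 h)).symm

lemma choose_eq_zero (σ : ChooserStrategy G) {i j : V} (hi : ¬ IsTerminal G i)
    (hj : ¬ G.Adj i j) (h : History V) (w : ℝ) : σ.choose h i w j = 0 := by
  by_contra hne
  exact hj (σ.choose_adj h i w hi j hne)

lemma chooserProb_of_not_adj (u : V → ℝ) {i j : V} (h : ¬ G.Adj i j) :
    chooserProb G u i j = 0 := if_neg h

lemma odds_eq_outDeg {i : V} (hi : 2 ≤ outDeg G i) : odds G i = outDeg G i :=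
  if_neg (by omega)

lemma chooserProbMin_le {u : V → ℝ} {i j : V} (hij : G.Adj i j) :
    chooserProbMin G u i ≤ chooserProb G u i j :=
  csInf_le (Set.toFinite _).bddBelow ⟨j, hij, rfl⟩

variable [DecidableEq V] {u : V → ℝ}

lemma sum_succs_eq (hfix : propMatrix G *ᵥ u = u) {i : V} (hi : ¬ IsTerminal G i) :
    ∑ j ∈ succs G i, u j = odds G i * u i := by
  have := congrFun hfix i
  rw [propMatrix_mulVec hi, div_eq_iff (odds_pos hi).ne'] at this
  rw [this, mul_comm]

/-- The limiting transition probabilities are the entries of the propagation matrix conjugated by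
the fixed vector `u`; for a vertex with one successor this uses `u i = u j / 2`. -/
lemma chooserProb_eq (hu : ∀ i, 0 < u i) (hfix : propMatrix G *ᵥ u = u) {i j : V}
    (hij : G.Adj i j) : chooserProb G u i j = u j / (odds G i * u i) := by
  have hs := sum_succs_eq hfix (not_isTerminal_of_adj hij)
  rw [chooserProb, if_pos hij, ← hs]
  split_ifs with h1
  · obtain ⟨a, ha⟩ := Finset.card_eq_one.1 (show (succs G i).card = 1 from h1)
    have hja : j ∈ succs G i := mem_succs.2 hij
    rw [ha, Finset.mem_singleton] at hja
    rw [ha, Finset.sum_singleton, hja, div_self (hu a).ne']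
  · rfl

lemma chooserProb_nonneg (hu : ∀ i, 0 < u i) (hfix : propMatrix G *ᵥ u = u) (i j : V) :
    0 ≤ chooserProb G u i j := by
  by_cases hij : G.Adj i j
  · rw [chooserProb_eq hu hfix hij]
    exact div_nonneg (hu j).le (mul_nonneg (odds_nonneg i) (hu i).le)
  · rw [chooserProb_of_not_adj u hij]

lemma sum_succs_chooserProb (hu : ∀ i, 0 < u i) (hfix : propMatrix G *ᵥ u = u) {i : V}
    (hi : ¬ IsTerminal G i) : ∑ j ∈ succs G i, chooserProb G u i j = 1 := by
  rw [Finset.sum_congr rfl fun j hj => chooserProb_eq hu hfix (mem_succs.1 hj),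
    ← Finset.sum_div, sum_succs_eq hfix hi]
  exact div_self (mul_pos (odds_pos hi) (hu i)).ne'

lemma sum_chooserProb (hu : ∀ i, 0 < u i) (hfix : propMatrix G *ᵥ u = u) {i : V}
    (hi : ¬ IsTerminal G i) : ∑ j, chooserProb G u i j = 1 := by
  rw [sum_eq_sum_succs fun j hj => chooserProb_of_not_adj u hj]
  exact sum_succs_chooserProb hu hfix hi

lemma chooserProbMin_nonneg (hu : ∀ i, 0 < u i) (hfix : propMatrix G *ᵥ u = u) (i : V) :
    0 ≤ chooserProbMin G u i := by
  refine Real.sInf_nonneg ?_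
  rintro _ ⟨j, -, rfl⟩
  exact chooserProb_nonneg hu hfix i j

lemma outDeg_mul_chooserProbMin_le (hu : ∀ i, 0 < u i) (hfix : propMatrix G *ᵥ u = u) {i : V}
    (hi : ¬ IsTerminal G i) : outDeg G i * chooserProbMin G u i ≤ 1 := by
  rw [← sum_succs_chooserProb hu hfix hi, ← card_succs, ← nsmul_eq_mul]
  exact Finset.card_nsmul_le_sum _ _ _ fun j hj => chooserProbMin_le (mem_succs.1 hj)

lemma exists_limitingChooser (hu : ∀ i, 0 < u i) (hfix : propMatrix G *ᵥ u = u) :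
    ∃ σ : ChooserStrategy G, IsLimitingChooser u σ := by
  have : ∀ i, ∃ q : PMF V, ¬ IsTerminal G i →
      ∀ j, q j = ENNReal.ofReal (chooserProb G u i j) := by
    intro i
    by_cases hi : IsTerminal G i
    · exact ⟨PMF.pure i, fun h => absurd hi h⟩
    · obtain ⟨q, hq⟩ := exists_pmf (chooserProb_nonneg hu hfix i) (sum_chooserProb hu hfix hi)
      exact ⟨q, fun _ => hq⟩
  choose q hq using this
  refine ⟨⟨fun _ i _ => q i, fun _ i _ hi j hj => ?_⟩, fun _ i _ j hi => hq i hi j⟩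
  by_contra hij
  rw [hq i hi j, chooserProb_of_not_adj u hij, ENNReal.ofReal_zero] at hj
  exact hj rfl

lemma limitingWager_mem (hu : ∀ i, 0 < u i) (hfix : propMatrix G *ᵥ u = u) {β : ℝ}
    (hβ : β ∈ Set.Icc (0 : ℝ) 1) {i : V} (hi : ¬ IsTerminal G i) :
    1 - (outDeg G i : ℝ) * β * chooserProbMin G u i ∈ Set.Icc (0 : ℝ) 1 := by
  have h1 := outDeg_mul_chooserProbMin_le hu hfix hi
  have h0 : 0 ≤ (outDeg G i : ℝ) * chooserProbMin G u i :=
    mul_nonneg (Nat.cast_nonneg _) (chooserProbMin_nonneg hu hfix i)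
  have h2 : (outDeg G i : ℝ) * β * chooserProbMin G u i =
    β * (outDeg G i * chooserProbMin G u i) := by ring
  rw [h2]
  constructor
  · have := mul_le_mul hβ.2 h1 h0 zero_le_one
    linarith
  · have := mul_nonneg hβ.1 h0
    linarith

lemma exists_limitingGuesser (hu : ∀ i, 0 < u i) (hfix : propMatrix G *ᵥ u = u) {β : ℝ}
    (hβ : β ∈ Set.Icc (0 : ℝ) 1) : ∃ τ : GuesserStrategy G, IsLimitingGuesser u β τ := by
  have key : ∀ i, ∃ (w : ℝ) (q : PMF V), 0 ≤ w ∧ w ≤ 1 ∧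
      (¬ IsTerminal G i → ∀ j, q j ≠ 0 → G.Adj i j) ∧
      (outDeg G i = 1 → w = 1 ∧ ∀ j, G.Adj i j → q j = 1) ∧
      (2 ≤ outDeg G i →
      w = 1 - (outDeg G i : ℝ) * β * chooserProbMin G u i ∧
      (1 - (outDeg G i : ℝ) * β * chooserProbMin G u i ≠ 0 → ∀ j, G.Adj i j →
        q j = ENNReal.ofReal
          ((chooserProb G u i j - β * chooserProbMin G u i) /
            (1 - (outDeg G i : ℝ) * β * chooserProbMin G u i)))) := by
    intro i
    by_cases hi : IsTerminal G i
    · have hi' : outDeg G i = 0 := hi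
      exact ⟨0, PMF.pure i, le_rfl, zero_le_one, fun h => absurd hi h, by omega, by omega⟩
    obtain ⟨a, ha⟩ := exists_adj hi
    have hpure : ∀ j, PMF.pure a j ≠ 0 → G.Adj i j := by
      intro j hj
      rw [← PMF.mem_support_iff, PMF.support_pure, Set.mem_singleton_iff] at hj
      rwa [hj]
    by_cases h1 : outDeg G i = 1
    · refine ⟨1, PMF.pure a, zero_le_one, le_rfl, fun _ => hpure, fun _ => ⟨rfl, ?_⟩, by omega⟩
      intro j hj
      obtain ⟨b, hb⟩ := Finset.card_eq_one.1 (show (succs G i).card = 1 from h1)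
      have haj : a = b ∧ j = b :=
        ⟨by simpa [hb] using mem_succs.2 ha, by simpa [hb] using mem_succs.2 hj⟩
      rw [haj.1, haj.2, PMF.pure_apply, if_pos rfl]
    set w := 1 - (outDeg G i : ℝ) * β * chooserProbMin G u i with hw
    have hw01 : w ∈ Set.Icc (0 : ℝ) 1 := limitingWager_mem hu hfix hβ hi
    by_cases hw0 : w = 0
    · exact ⟨w, PMF.pure a, hw01.1, hw01.2, fun _ => hpure, fun h => absurd h h1,
        fun _ => ⟨rfl, fun h => absurd hw0 h⟩⟩
    have hnn : ∀ j, G.Adj i j → 0 ≤ (chooserProb G u i j - β * chooserProbMin G u i) / w := by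
      intro j hj
      refine div_nonneg ?_ hw01.1
      have := mul_le_mul hβ.2 (chooserProbMin_le (u := u) hj) (chooserProbMin_nonneg hu hfix i)
        zero_le_one
      linarith
    obtain ⟨q, hq⟩ := exists_pmf
      (p := fun j => if G.Adj i j then (chooserProb G u i j - β * chooserProbMin G u i) / w else 0)
      (fun j => by
        split_ifs with hj
        · exact hnn j hj
        · exact le_rfl)
      (by
        rw [← Finset.sum_filter, ← Finset.sum_div, Finset.sum_sub_distrib, Finset.sum_const,
          nsmul_eq_mul]
        change (∑ j ∈ succs G i, chooserProb G u i j - outDeg G i * _) / w = 1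
        rw [sum_succs_chooserProb hu hfix hi, ← mul_assoc, ← hw, div_self hw0])
    refine ⟨w, q, hw01.1, hw01.2, fun _ j hj => ?_, fun h => absurd h h1,
      fun _ => ⟨rfl, fun _ j hj => ?_⟩⟩
    · by_contra hij
      rw [hq j, if_neg hij, ENNReal.ofReal_zero] at hj
      exact hj rfl
    · rw [hq j, if_pos hj]
  choose w q h0 h1 hadj hone htwo using key
  exact ⟨⟨fun _ i => w i, fun _ => h0, fun _ => h1, fun _ i => q i, fun _ => hadj⟩,
    fun _ i => ⟨hone i, htwo i⟩⟩

lemma sum_guess_mul_roundFactor (q : PMF V) {i : V} {w : ℝ} (h0 : 0 ≤ w) (h1 : w ≤ 1) (j : V) :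
    ∑ g, q g * ENNReal.ofReal (roundFactor G i w g j) =
      ENNReal.ofReal (1 - w) + q j * ENNReal.ofReal (odds G i * w) := by
  have hm : 0 ≤ odds G i * w := mul_nonneg (odds_nonneg i) h0
  have : ∀ g, q g * ENNReal.ofReal (roundFactor G i w g j) =
      q g * ENNReal.ofReal (1 - w) + if g = j then q g * ENNReal.ofReal (odds G i * w) else 0 := by
    intro g
    unfold roundFactor
    split_ifs
    · rw [ENNReal.ofReal_add (by linarith) hm, mul_add]
    · simp
  simp only [this, Finset.sum_add_distrib, ← Finset.sum_mul, sum_pmf, one_mul,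
    Finset.sum_ite_eq', Finset.mem_univ, if_true]

/-- Whatever successor `j` is chosen, the limiting guess multiplies the expected fortune by
`u j / u i`. -/
lemma sum_limitingGuess_mul_roundFactor (hu : ∀ i, 0 < u i) (hfix : propMatrix G *ᵥ u = u) {β : ℝ}
    (hβ : β ∈ Set.Icc (0 : ℝ) 1) {τ : GuesserStrategy G} (hτ : IsLimitingGuesser u β τ)
    (h : History V) {i j : V} (hij : G.Adj i j) :
    ∑ g, τ.guess h i g * ENNReal.ofReal (roundFactor G i (τ.wager h i) g j) =
      ENNReal.ofReal (u j / u i) := by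
  have hi := not_isTerminal_of_adj hij
  have hp := chooserProb_eq hu hfix hij
  have hmp : odds G i * chooserProb G u i j = u j / u i := by
    rw [hp]
    have := (odds_pos hi).ne'
    have := (hu i).ne'
    field_simp
  rw [sum_guess_mul_roundFactor _ (τ.wager_nonneg h i) (τ.wager_le_one h i), ← hmp]
  by_cases h1 : outDeg G i = 1
  · obtain ⟨hw, hg⟩ := (hτ h i).1 h1
    rw [hw, hg j hij]
    simp [chooserProb, hij, h1]
  have h2 : 2 ≤ outDeg G i := by
    have : outDeg G i ≠ 0 := hi
    omega
  obtain ⟨hw, hg⟩ := (hτ h i).2 h2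
  have hw01 := limitingWager_mem hu hfix hβ hi
  rw [hw, odds_eq_outDeg h2]
  set w := 1 - (outDeg G i : ℝ) * β * chooserProbMin G u i with hwdef
  by_cases hw0 : w = 0
  · -- a zero wager forces `β = 1` and `p_min = 1 / n_i`, so that all `p_{i,j}` are `1 / n_i`
    rw [hw0]
    have hmin : (outDeg G i : ℝ) * chooserProbMin G u i = 1 := by
      refine le_antisymm (outDeg_mul_chooserProbMin_le hu hfix hi) ?_
      have h0 : 0 ≤ (outDeg G i : ℝ) * chooserProbMin G u i :=
        mul_nonneg (Nat.cast_nonneg _) (chooserProbMin_nonneg hu hfix i)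
      have := mul_le_of_le_one_left h0 hβ.2
      have : β * ((outDeg G i : ℝ) * chooserProbMin G u i) = 1 := by
        rw [hwdef] at hw0; linarith
      linarith
    have hsum : ∑ _k ∈ succs G i, chooserProbMin G u i = ∑ k ∈ succs G i, chooserProb G u i k := by
      rw [sum_succs_chooserProb hu hfix hi, Finset.sum_const, nsmul_eq_mul, card_succs, hmin]
    have hj := (Finset.sum_eq_sum_iff_of_le fun k hk =>
      chooserProbMin_le (u := u) (mem_succs.1 hk)).1 hsum j (mem_succs.2 hij)
    rw [← hj, hmin]
    simp
  · have hle : β * chooserProbMin G u i ≤ chooserProb G u i j := by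
      have := mul_le_mul hβ.2 (chooserProbMin_le (u := u) hij) (chooserProbMin_nonneg hu hfix i)
        zero_le_one
      linarith
    rw [hg hw0 j hij, ← ENNReal.ofReal_mul (div_nonneg (sub_nonneg.2 hle) hw01.1),
      ← ENNReal.ofReal_add (sub_nonneg.2 hw01.2)
        (mul_nonneg (div_nonneg (sub_nonneg.2 hle) hw01.1)
          (mul_nonneg (Nat.cast_nonneg _) hw01.1))]
    congr 1
    field_simp
    rw [hwdef]
    ring

end LimitingStrategies

/-! ### Bounds for the limiting strategies -/

section Bounds

variable {V : Type*} [Fintype V] {G : Digraph V} [DecidableRel G.Adj]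

lemma IsLimitingChooser.isGuessBlind {u : V → ℝ} {σ : ChooserStrategy G}
    (hσ : IsLimitingChooser u σ) : σ.IsGuessBlind := by
  intro h h' i w hi _
  ext j
  rw [hσ h i w j hi, hσ h' i w j hi]

lemma IsLimitingGuesser.wager_eq {u : V → ℝ} {β : ℝ} {τ : GuesserStrategy G}
    (hτ : IsLimitingGuesser u β τ) {i : V} (hi : ¬ IsTerminal G i) (h h' : History V) : τ.wager h i = τ.wager h' i := by
  by_cases h1 : outDeg G i = 1
  · rw [((hτ h i).1 h1).1, ((hτ h' i).1 h1).1]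
  · have h2 : 2 ≤ outDeg G i := by
      have : outDeg G i ≠ 0 := hi
      omega
    rw [((hτ h i).2 h2).1, ((hτ h' i).2 h2).1]

lemma expect_step_eq_sum_choose (σ : ChooserStrategy G) (τ : GuesserStrategy G) {h : History V}
    {i : V} (hi : ¬ IsTerminal G i) {f : History V × V → ℝ≥0∞} {F : V → ℝ≥0∞}
    (hF : ∀ g j, f (⟨i, τ.wager h i, g, j⟩ :: h, j) = F j) :
    expect (step σ τ (h, i)) f = ∑ j, σ.choose h i (τ.wager h i) j * F j := by
  rw [expect_step _ _ hi]
  simp only [hF, ← Finset.sum_mul, sum_pmf, one_mul]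

variable [DecidableEq V] {u val : V → ℝ} {σ : ChooserStrategy G} {τ : GuesserStrategy G}

/-- Summed over the successors, the round factors amount to at most `m_i`, whatever the wager and
the guess. -/
lemma sum_succs_roundFactor_le {i : V} {w : ℝ} (h0 : 0 ≤ w) (h1 : w ≤ 1) (g : V) :
    ∑ j ∈ succs G i, roundFactor G i w g j ≤ odds G i := by
  have hm : 0 ≤ odds G i * w := mul_nonneg (odds_nonneg i) h0
  simp only [roundFactor, Finset.sum_add_distrib, Finset.sum_const, nsmul_eq_mul, card_succs,
    Finset.sum_ite_eq]
  have h2 := mul_le_mul_of_nonneg_right (outDeg_le_odds (G := G) i) (sub_nonneg.2 h1)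
  have h3 : (if g ∈ succs G i then odds G i * w else 0) ≤ odds G i * w := by
    split_ifs
    · exact le_rfl
    · exact hm
  linarith

/-- Against the limiting Chooser, the fortune divided by `u` is a supermartingale. -/
lemma expect_step_limitingChooser_le (hu : ∀ i, 0 < u i) (hfix : propMatrix G *ᵥ u = u)
    (hσ : IsLimitingChooser u σ) (s : History V × V) :
    expect (step σ τ s) (fun s => ENNReal.ofReal (fortune G s.1) * ENNReal.ofReal (u s.2)⁻¹) ≤
      ENNReal.ofReal (fortune G s.1) * ENNReal.ofReal (u s.2)⁻¹ := by
  obtain ⟨h, i⟩ := s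
  by_cases hi : IsTerminal G i
  · rw [expect_step_of_isTerminal _ _ hi]
  rw [expect_step _ _ hi]
  set w := τ.wager h i
  have hw0 : 0 ≤ w := τ.wager_nonneg h i
  have hw1 : w ≤ 1 := τ.wager_le_one h i
  have inner : ∀ g, ∑ j, σ.choose h i w j * (ENNReal.ofReal (fortune G (⟨i, w, g, j⟩ :: h)) *
      ENNReal.ofReal (u j)⁻¹) ≤ ENNReal.ofReal (fortune G h) * ENNReal.ofReal (u i)⁻¹ := by
    intro g
    rw [sum_eq_sum_succs fun j hj => by rw [choose_eq_zero σ hi hj, zero_mul]]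
    have hterm : ∀ j ∈ succs G i, σ.choose h i w j *
        (ENNReal.ofReal (fortune G (⟨i, w, g, j⟩ :: h)) * ENNReal.ofReal (u j)⁻¹) =
        ENNReal.ofReal (fortune G h) *
          ENNReal.ofReal (roundFactor G i w g j / (odds G i * u i)) := by
      intro j hj
      have hrf := roundFactor_nonneg (G := G) hw0 hw1 i g j
      have huj := hu j
      rw [hσ h i w j hi, ofReal_fortune_cons hw0 hw1,
        show roundFactor G i w g j / (odds G i * u i) =
          chooserProb G u i j * roundFactor G i w g j * (u j)⁻¹ by
          rw [chooserProb_eq hu hfix (mem_succs.1 hj)]; field_simp,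
        ENNReal.ofReal_mul (mul_nonneg (chooserProb_nonneg hu hfix i j) hrf),
        ENNReal.ofReal_mul (chooserProb_nonneg hu hfix i j)]
      ring
    rw [Finset.sum_congr rfl hterm, ← Finset.mul_sum, ← ENNReal.ofReal_sum_of_nonneg fun j _ =>
      div_nonneg (roundFactor_nonneg hw0 hw1 i g j) (mul_nonneg (odds_nonneg i) (hu i).le),
      ← Finset.sum_div]
    gcongr
    rw [div_le_iff₀ (mul_pos (odds_pos hi) (hu i))]
    refine (sum_succs_roundFactor_le hw0 hw1 g).trans_eq ?_
    have := (hu i).ne'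
    field_simp
  refine (Finset.sum_le_sum fun g _ => mul_le_mul_right (inner g) _).trans ?_
  rw [← Finset.sum_mul, sum_pmf, one_mul]

lemma finalFortune_limitingChooser_le (hu : ∀ i, 0 < u i) (hfix : propMatrix G *ᵥ u = u)
    (huT : ∀ k, IsTerminal G k → u k = (val k)⁻¹) (hσ : IsLimitingChooser u σ) (i : V) :
    finalFortune val σ τ i ≤ ENNReal.ofReal (u i)⁻¹ := by
  refine iSup_le fun t => ?_
  have h := antitone_expect_law (expect_step_limitingChooser_le (τ := τ) hu hfix hσ) i
    (Nat.zero_le t)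
  simp only [expect_law_zero, fortune, ENNReal.ofReal_one, one_mul] at h
  refine le_trans (expect_mono fun s => ?_) h
  split_ifs with hs
  · rw [ENNReal.ofReal_mul' (by rw [← inv_inv (val s.2), ← huT _ hs]; exact (inv_pos.2 (hu _)).le),
      huT _ hs, inv_inv]
  · exact zero_le

/-- Under the limiting transition probabilities the probability that play lasts beyond time `t` is
`(M ^ t y) i / u i`, where `y` is `u` with zeros put at the terminal vertices; this tends to zero. -/
lemma endsAS_limitingChooser (hG : IsTerminating G) (hu : ∀ i, 0 < u i)
    (hfix : propMatrix G *ᵥ u = u) (hσ : IsLimitingChooser u σ) (i : V) : EndsAS σ τ i := by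
  set y : V → ℝ := fun j => u j * nonterminalInd G j with hy
  have hy0 : 0 ≤ y := fun j => mul_nonneg (hu j).le (nonterminalInd_nonneg j)
  set x : ℕ → V → ℝ≥0∞ := fun k j => ENNReal.ofReal ((propMatrix G ^ k *ᵥ y) j / u j) with hx
  have hsurv : ∀ t, survival σ τ i t = x t i := by
    intro t
    have := expect_law_eq_iterate (σ := σ) (τ := τ) (x := x)
      (fun k j hj => by simp only [hx, propMatrix_pow_mulVec_of_isTerminal _ hj])
      (fun k h j w hj => by
        rw [sum_eq_sum_succs fun l hl => by rw [choose_eq_zero σ hj hl, zero_mul]]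
        have hterm : ∀ l ∈ succs G j, σ.choose h j w l * x k l =
            ENNReal.ofReal ((propMatrix G ^ k *ᵥ y) l / (odds G j * u j)) := by
          intro l hl
          have := (hu l).ne'
          rw [hσ h j w l hj, ← ENNReal.ofReal_mul (chooserProb_nonneg hu hfix j l),
            chooserProb_eq hu hfix (mem_succs.1 hl)]
          congr 1
          field_simp
        rw [Finset.sum_congr rfl hterm, ← ENNReal.ofReal_sum_of_nonneg fun l _ =>
          div_nonneg (propMatrix_pow_mulVec_nonneg k hy0 l)
            (mul_nonneg (odds_nonneg j) (hu j).le), ← Finset.sum_div]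
        simp only [hx, propMatrix_pow_succ_mulVec, propMatrix_mulVec hj, div_div]) i t 0
    rw [add_zero] at this
    rw [← this, survival]
    congr 1
    funext s
    have := (hu s.2).ne'
    simp only [hx, hy, pow_zero, Matrix.one_mulVec, nonterminalInd]
    split_ifs <;> simp [this]
  rw [endsAS_iff_survival]
  have h0 := tendsto_pi_nhds.1 (tendsto_pow_mulVec_zero hG (y := y)
    fun k hk => by simp [hy, nonterminalInd, hk]) i
  have h1 := ENNReal.tendsto_ofReal (h0.div_const (u i))
  simp only [Pi.zero_apply, zero_div, ENNReal.ofReal_zero] at h1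
  exact h1.congr fun t => (hsurv t).symm

lemma payoff_limitingChooser_le (hG : IsTerminating G) (hu : ∀ i, 0 < u i)
    (hfix : propMatrix G *ᵥ u = u) (huT : ∀ k, IsTerminal G k → u k = (val k)⁻¹)
    (hσ : IsLimitingChooser u σ) (i : V) : payoff val σ τ i ≤ ENNReal.ofReal (u i)⁻¹ := by
  rw [payoff, if_pos (endsAS_limitingChooser hG hu hfix hσ i)]
  exact finalFortune_limitingChooser_le hu hfix huT hσ i

/-- Against a guess-blind Chooser the conditional expectation of the fortune under the limiting
guess, given the public part of the play, is `u (X_t) / u i`. It is stated by testing against all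
functions `f` of the public part and the position. -/
lemma expect_law_limitingGuesser (hu : ∀ i, 0 < u i) (hfix : propMatrix G *ᵥ u = u) {β : ℝ}
    (hβ : β ∈ Set.Icc (0 : ℝ) 1) (hτ : IsLimitingGuesser u β τ) (hσ : σ.IsGuessBlind) (i : V)
    (t : ℕ) (f : History V × V → ℝ≥0∞)
    (hf : ∀ h h' j, publicPart h = publicPart h' → f (h, j) = f (h', j)) :
    expect (law σ τ i t) (fun s =>
      ENNReal.ofReal (fortune G s.1) * ENNReal.ofReal (u s.2)⁻¹ * f s) =
      ENNReal.ofReal (u i)⁻¹ * expect (law σ τ i t) f := by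
  induction t generalizing f with
  | zero => simp [expect_law_zero, fortune]
  | succ t ih =>
    rw [expect_law_succ, expect_law_succ, ← ih (fun s => expect (step σ τ s) f)]
    · congr 1
      funext ⟨h, l⟩
      by_cases hl : IsTerminal G l
      · rw [expect_step_of_isTerminal _ _ hl, expect_step_of_isTerminal _ _ hl]
      set w := τ.wager h l with hw
      have hw0 : 0 ≤ w := τ.wager_nonneg h l
      have hw1 : w ≤ 1 := τ.wager_le_one h l
      -- the test function does not see the guess, which may be replaced by the choice
      have hpub : ∀ g j, f (⟨l, w, g, j⟩ :: h, j) = f (⟨l, w, j, j⟩ :: h, j) :=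
        fun g j => hf _ _ _ rfl
      rw [expect_step_eq_sum_choose σ τ hl hpub, expect_step _ _ hl, ← hw]
      simp only [Finset.mul_sum]
      rw [Finset.sum_comm]
      refine Finset.sum_congr rfl fun j _ => ?_
      by_cases hj : G.Adj l j
      · have hterm : ∀ g, τ.guess h l g * (σ.choose h l w j *
            (ENNReal.ofReal (fortune G (⟨l, w, g, j⟩ :: h)) * ENNReal.ofReal (u j)⁻¹ *
              f (⟨l, w, g, j⟩ :: h, j))) =
            τ.guess h l g * ENNReal.ofReal (roundFactor G l w g j) *
              (σ.choose h l w j * (ENNReal.ofReal (fortune G h) * ENNReal.ofReal (u j)⁻¹ *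
              f (⟨l, w, j, j⟩ :: h, j))) := by
          intro g
          rw [ofReal_fortune_cons hw0 hw1, hpub g j]
          ring
        simp only [hterm]
        rw [← Finset.sum_mul, hw, sum_limitingGuess_mul_roundFactor hu hfix hβ hτ h hj, ← hw]
        have huj := hu j
        have hul := hu l
        rw [show (u l)⁻¹ = u j / u l * (u j)⁻¹ by field_simp,
          ENNReal.ofReal_mul (div_nonneg huj.le hul.le)]
        ring
      · simp [choose_eq_zero σ hl hj]
    · intro h h' j hh
      by_cases hj : IsTerminal G j
      · rw [expect_step_of_isTerminal _ _ hj, expect_step_of_isTerminal _ _ hj]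
        exact hf _ _ _ hh
      have hw := hτ.wager_eq hj h' h
      rw [expect_step_eq_sum_choose σ τ hj (F := fun k => f (⟨j, τ.wager h j, k, k⟩ :: h, k))
          fun g k => hf _ _ _ rfl,
        expect_step_eq_sum_choose σ τ hj (F := fun k => f (⟨j, τ.wager h j, k, k⟩ :: h, k))
          fun g k => hf _ _ _ (by rw [hw]; simp only [publicPart, List.map_cons] at hh ⊢; rw [hh]),
        hw, hσ h h' j _ hj hh]

lemma finalFortune_limitingGuesser (hu : ∀ i, 0 < u i) (hfix : propMatrix G *ᵥ u = u)
    (huT : ∀ k, IsTerminal G k → u k = (val k)⁻¹) {β : ℝ}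
    (hβ : β ∈ Set.Icc (0 : ℝ) 1) (hτ : IsLimitingGuesser u β τ) (hσ : σ.IsGuessBlind) {i : V}
    (hend : EndsAS σ τ i) : finalFortune val σ τ i = ENNReal.ofReal (u i)⁻¹ := by
  have h : ∀ t, (expect (law σ τ i t) fun s =>
      if IsTerminal G s.2 then ENNReal.ofReal (fortune G s.1 * val s.2) else 0) =
      ENNReal.ofReal (u i)⁻¹ * endProb σ τ i t := by
    intro t
    rw [endProb, ← expect_law_limitingGuesser hu hfix hβ hτ hσ i t _ fun h h' j _ => rfl]
    congr 1
    funext s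
    split_ifs with hs
    · rw [ENNReal.ofReal_mul'
        (by rw [← inv_inv (val s.2), ← huT _ hs]; exact (inv_pos.2 (hu _)).le),
        huT _ hs, inv_inv, mul_one]
    · rw [mul_zero]
  rw [finalFortune]
  simp only [h]
  rw [← ENNReal.mul_iSup, endsAS_iff_iSup.1 hend, mul_one]

lemma le_guarantee_limitingGuesser (hu : ∀ i, 0 < u i) (hfix : propMatrix G *ᵥ u = u)
    (huT : ∀ k, IsTerminal G k → u k = (val k)⁻¹) {β : ℝ}
    (hβ : β ∈ Set.Icc (0 : ℝ) 1) (hτ : IsLimitingGuesser u β τ) (i : V) :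
    ENNReal.ofReal (u i)⁻¹ ≤ guarantee val τ i :=
  le_iInf fun _ => le_iInf fun hσ => le_iInf fun hend =>
    (finalFortune_limitingGuesser hu hfix huT hβ hτ hσ hend).ge

lemma guarantee_le (hG : IsTerminating G) (hu : ∀ i, 0 < u i) (hfix : propMatrix G *ᵥ u = u)
    (huT : ∀ k, IsTerminal G k → u k = (val k)⁻¹) (τ : GuesserStrategy G) (i : V) :
    guarantee val τ i ≤ ENNReal.ofReal (u i)⁻¹ := by
  obtain ⟨σ, hσ⟩ := exists_limitingChooser hu hfix
  exact iInf_le_of_le σ (iInf_le_of_le hσ.isGuessBlind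
    (iInf_le_of_le (endsAS_limitingChooser hG hu hfix hσ i)
      (finalFortune_limitingChooser_le hu hfix huT hσ i)))

end Bounds

/-! ### The greedy Guesser with finite horizon -/

section GreedyGuesser

variable {V : Type*} [Fintype V] {G : Digraph V} [DecidableRel G.Adj]

/-- A lower bound `c ≤ 1` for the terminal values, with which the fortune at a non-terminal vertex
is discounted. -/
lemma exists_pos_le_val {val : V → ℝ} (hval : ∀ k, IsTerminal G k → 0 < val k) :
    ∃ c : ℝ, 0 < c ∧ c ≤ 1 ∧ ∀ k, IsTerminal G k → c ≤ val k := by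
  obtain ⟨⟨c, hc⟩, hle⟩ := (Set.finite_range fun i : V =>
    if h : IsTerminal G i then (⟨val i, hval i h⟩ : Set.Ioi (0 : ℝ)) else ⟨1, Set.mem_Ioi.2 one_pos⟩).bddBelow
  refine ⟨min c 1, lt_min hc one_pos, min_le_right _ _, fun k hk => (min_le_left _ _).trans ?_⟩
  have := hle ⟨k, rfl⟩
  dsimp only at this
  rw [dif_pos hk] at this
  exact this

variable [DecidableEq V] {val : V → ℝ} {σ : ChooserStrategy G}

lemma roundFactor_zero (i g j : V) : roundFactor G i 0 g j = 1 := by simp [roundFactor]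

lemma roundFactor_one_self (i j : V) : roundFactor G i 1 j j = odds G i := by simp [roundFactor]

/-- Let `f k i` be a goal for the fortune at `i` with `k` rounds to go, such that some guess with
full wager turns the goal for `k + 1` rounds into the goal for `k` rounds on average. The Guesser who
makes such guesses for `K` rounds and then never wagers again has payoff at least `f K i`. -/
lemma exists_le_payoff_of_goals {c : ℝ} (hc1 : c ≤ 1) {f : ℕ → V → ℝ≥0∞}
    (hval : ∀ k, IsTerminal G k → 0 < val k)
    (hT : ∀ k i, IsTerminal G i → f k i ≤ ENNReal.ofReal (val i))
    (h0 : ∀ i, ¬ IsTerminal G i → f 0 i = ENNReal.ofReal c)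
    (hlow : ∀ i, ENNReal.ofReal c ≤ f 0 i)
    (hN : ∀ k h i, ¬ IsTerminal G i → ∃ g, G.Adj i g ∧
      f (k + 1) i ≤ ENNReal.ofReal (odds G i) * σ.choose h i 1 g * f k g) (K : ℕ) (i : V) :
    ∃ τ : GuesserStrategy G, f K i ≤ payoff val σ τ i := by
  have hN' : ∀ k h i, ∃ g, ¬ IsTerminal G i → G.Adj i g ∧
      f (k + 1) i ≤ ENNReal.ofReal (odds G i) * σ.choose h i 1 g * f k g := by
    intro k h i
    by_cases hi : IsTerminal G i
    · exact ⟨i, fun h => absurd hi h⟩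
    · obtain ⟨g, hg⟩ := hN k h i hi
      exact ⟨g, fun _ => hg⟩
  choose g hg using hN'
  let τ : GuesserStrategy G :=
    { wager := fun h _ => if h.length < K then 1 else 0
      wager_nonneg := fun h _ => by split_ifs <;> norm_num
      wager_le_one := fun h _ => by split_ifs <;> norm_num
      guess := fun h i => PMF.pure (g (K - (h.length + 1)) h i)
      guess_adj := fun h i hi j hj => by
        rw [← PMF.mem_support_iff, PMF.support_pure, Set.mem_singleton_iff] at hj
        rw [hj]
        exact (hg _ h i hi).1 }
  have hstep : ∀ (h : History V) (i : V), ¬ IsTerminal G i → ∀ F : History V × V → ℝ≥0∞,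
      expect (step σ τ (h, i)) F = ∑ j, σ.choose h i (τ.wager h i) j *
        F (⟨i, τ.wager h i, g (K - (h.length + 1)) h i, j⟩ :: h, j) := by
    intro h i hi F
    rw [expect_step _ _ hi, Finset.sum_eq_single (g (K - (h.length + 1)) h i)]
    · simp [τ, PMF.pure_apply]
    · intro b _ hb
      simp [τ, PMF.pure_apply, hb]
    · simp
  set Ψ : History V × V → ℝ≥0∞ :=
    fun s => ENNReal.ofReal (fortune G s.1) * f (K - s.1.length) s.2 with hΨ
  have hsub : ∀ s, Ψ s ≤ expect (step σ τ s) Ψ := by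
    rintro ⟨h, i⟩
    by_cases hi : IsTerminal G i
    · rw [expect_step_of_isTerminal _ _ hi]
    rw [hstep h i hi]
    by_cases hlen : h.length < K
    · have hw : τ.wager h i = 1 := if_pos hlen
      obtain ⟨k, hk⟩ : ∃ k, K = h.length + 1 + k := Nat.exists_eq_add_of_le hlen
      have e1 : K - h.length = k + 1 := by omega
      have e2 : K - (h.length + 1) = k := by omega
      rw [hw, e2]
      refine le_trans ?_ (Finset.single_le_sum (fun _ _ => zero_le) (Finset.mem_univ (g k h i)))
      simp only [hΨ, List.length_cons, e1, e2]
      rw [ofReal_fortune_cons zero_le_one le_rfl, roundFactor_one_self]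
      calc ENNReal.ofReal (fortune G h) * f (k + 1) i
          ≤ ENNReal.ofReal (fortune G h) * (ENNReal.ofReal (odds G i) * σ.choose h i 1 (g k h i) *
            f k (g k h i)) := mul_le_mul_right (hg k h i hi).2 _
        _ = _ := by ring
    · have hw : τ.wager h i = 0 := if_neg hlen
      have e1 : K - h.length = 0 := by omega
      have e2 : K - (h.length + 1) = 0 := by omega
      simp only [hw, hΨ, List.length_cons, e1, e2, h0 i hi,
        ofReal_fortune_cons le_rfl zero_le_one, roundFactor_zero, ENNReal.ofReal_one, one_mul]
      calc ENNReal.ofReal (fortune G h) * ENNReal.ofReal c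
          = ∑ j, σ.choose h i 0 j * (ENNReal.ofReal (fortune G h) * ENNReal.ofReal c) := by
            rw [← Finset.sum_mul, sum_pmf, one_mul]
        _ ≤ _ := Finset.sum_le_sum fun j _ => by gcongr; exact hlow j
  -- the fortune stays below `B ^ K`, since only the first `K` rounds change it
  set B : ℝ := 1 + ∑ j, odds G j with hB
  have hB1 : 1 ≤ B := by
    rw [hB]
    exact le_add_of_nonneg_right (Finset.sum_nonneg fun j _ => odds_nonneg j)
  have hsupp := law_support_induction (σ := σ) (τ := τ) (i := i)
    (fun t s => (¬ IsTerminal G s.2 → s.1.length = t) ∧ 0 ≤ fortune G s.1 ∧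
      fortune G s.1 ≤ B ^ min s.1.length K)
    ⟨fun _ => rfl, by simp [fortune], by simp [fortune]⟩
    (fun t h k hk ⟨_, h2, h3⟩ => ⟨fun hk' => absurd hk hk', h2, h3⟩)
    (fun t h k g j hk ⟨h1, h2, h3⟩ => by
      have hrf := roundFactor_nonneg (G := G) (τ.wager_nonneg h k) (τ.wager_le_one h k) k g j
      refine ⟨fun _ => by simp [h1 hk], ?_, ?_⟩
      · rw [fortune_cons]
        exact mul_nonneg hrf h2
      · rw [fortune_cons, List.length_cons]
        by_cases hlen : h.length < K
        · have hw : τ.wager h k = 1 := if_pos hlen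
          have e : min (h.length + 1) K = min h.length K + 1 := by omega
          have hle : roundFactor G k (τ.wager h k) g j ≤ B := by
            have := Finset.single_le_sum (f := odds G) (fun j _ => odds_nonneg j)
              (Finset.mem_univ k)
            have := odds_nonneg (G := G) k
            rw [hw, roundFactor, hB]
            split_ifs <;> linarith
          rw [e, pow_succ']
          exact mul_le_mul hle h3 h2 (by linarith)
        · have hw : τ.wager h k = 0 := if_neg hlen
          have e : min (h.length + 1) K = min h.length K := by omega
          rw [hw, roundFactor_zero, one_mul, e]
          exact h3)
  have hle : ∀ t, f K i ≤ expect (law σ τ i t) Ψ := by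
    intro t
    have := monotone_expect_law hsub i (Nat.zero_le t)
    simpa [expect_law_zero, hΨ, fortune] using this
  refine ⟨τ, ?_⟩
  have hterm : ∀ s : History V × V, IsTerminal G s.2 →
      Ψ s ≤ ENNReal.ofReal (fortune G s.1 * val s.2) := by
    intro s hs
    rw [ENNReal.ofReal_mul' (hval _ hs).le]
    exact mul_le_mul_right (hT _ _ hs) _
  have hnont : ∀ t, K ≤ t → ∀ s ∈ (law σ τ i t).support, ¬ IsTerminal G s.2 →
      Ψ s ≤ ENNReal.ofReal (fortune G s.1) := by
    intro t ht s hs hns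
    have hlen := (hsupp t s hs).1 hns
    simp only [hΨ, hlen, Nat.sub_eq_zero_of_le ht, h0 _ hns]
    exact mul_le_of_le_one_right' (ENNReal.ofReal_le_one.2 hc1)
  unfold payoff
  split_ifs with hend
  · -- the part of the expectation where play continues is at most `B ^ K` times its probability
    have hfin : ∀ t, K ≤ t → f K i ≤
        finalFortune val σ τ i + ENNReal.ofReal (B ^ K) * survival σ τ i t := by
      intro t ht
      refine (hle t).trans (le_trans ?_ (add_le_add_left (le_iSup (fun t =>
        expect (law σ τ i t) fun s =>
          if IsTerminal G s.2 then ENNReal.ofReal (fortune G s.1 * val s.2) else 0) t) _))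
      rw [survival, ← expect_const_mul, ← expect_add]
      refine expect_mono_of_support fun s hs => ?_
      split_ifs with hsT
      · exact (hterm s hsT).trans le_self_add
      · rw [zero_add, mul_one]
        refine (hnont t ht s hs hsT).trans (ENNReal.ofReal_le_ofReal ?_)
        exact (hsupp t s hs).2.2.trans (pow_le_pow_right₀ hB1 (min_le_right _ _))
    have hlim := (ENNReal.Tendsto.const_mul (endsAS_iff_survival.1 hend)
      (Or.inr (ENNReal.ofReal_ne_top (r := B ^ K)))).const_add (finalFortune val σ τ i)
    rw [mul_zero, add_zero] at hlim
    exact ge_of_tendsto hlim (eventually_atTop.2 ⟨K, hfin⟩)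
  · refine le_limsup_of_frequently_le (Eventually.frequently (eventually_atTop.2 ⟨K, ?_⟩))
    intro t ht
    refine (hle t).trans (expect_mono_of_support fun s hs => ?_)
    split_ifs with hsT
    · exact hterm s hsT
    · exact hnont t ht s hs hsT

/-- The goals of the greedy Guesser are quotients `x k i / (M ^ k y) i`, where `x` is a
subsolution for the Chooser's transition probabilities: if the quotients at the successors with
their probabilities all fell short, then so would their average with weights `(M ^ k y) j`. -/
lemma exists_le_payoff_mul {c : ℝ} (hc : 0 < c) (hc1 : c ≤ 1)
    (hcval : ∀ k, IsTerminal G k → c ≤ val k) {y : V → ℝ} (hy : ∀ i, 0 < y i)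
    {x : ℕ → V → ℝ≥0∞}
    (hx0 : ∀ i, x 0 i ≤ ENNReal.ofReal (if IsTerminal G i then val i else c) *
      ENNReal.ofReal (y i))
    (hxT : ∀ k i, IsTerminal G i → x k i = x 0 i)
    (hxN : ∀ k h i, ¬ IsTerminal G i → x (k + 1) i ≤ ∑ j, σ.choose h i 1 j * x k j)
    (K : ℕ) (i : V) : ∃ τ : GuesserStrategy G,
      x K i ≤ payoff val σ τ i * ENNReal.ofReal ((propMatrix G ^ K *ᵥ y) i) := by
  set Φ : V → ℝ≥0∞ := fun i => ENNReal.ofReal (if IsTerminal G i then val i else c) with hΦ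
  set Y : ℕ → V → ℝ≥0∞ := fun k i => ENNReal.ofReal ((propMatrix G ^ k *ᵥ y) i) with hY
  have hYpos : ∀ k i, Y k i ≠ 0 := fun k i =>
    (ENNReal.ofReal_pos.2 (propMatrix_pow_mulVec_pos k hy i)).ne'
  have hYtop : ∀ k i, Y k i ≠ ⊤ := fun k i => ENNReal.ofReal_ne_top
  set f : ℕ → V → ℝ≥0∞ := fun k i => if k = 0 then Φ i else x k i / Y k i with hf
  have hxf : ∀ k i, x k i ≤ f k i * Y k i := by
    intro k i
    by_cases hk : k = 0
    · subst hk
      simpa [hf, hY] using hx0 i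
    · simp only [hf, hk, if_false]
      rw [ENNReal.div_mul_cancel (hYpos k i) (hYtop k i)]
  obtain ⟨τ, hτ⟩ := exists_le_payoff_of_goals (σ := σ) (val := val) (f := f) hc1
    (fun k hk => hc.trans_le (hcval k hk))
    (fun k i hi => by
      by_cases hk : k = 0
      · simp [hf, hk, hΦ, hi]
      · simp only [hf, hk, if_false]
        refine ENNReal.div_le_of_le_mul ?_
        simpa [hxT k i hi, hY, propMatrix_pow_mulVec_of_isTerminal k hi, hΦ, hi] using hx0 i)
    (fun i hi => by simp [hf, hΦ, hi])
    (fun i => by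
      simp only [hf, hΦ, if_true]
      refine ENNReal.ofReal_le_ofReal ?_
      split_ifs with hi
      · exact hcval i hi
      · exact le_rfl)
    (fun k h i hi => by
      obtain ⟨a, ha⟩ := exists_adj hi
      obtain ⟨g, hg, hmax⟩ := Finset.exists_max_image (succs G i)
        (fun j => σ.choose h i 1 j * f k j) ⟨a, mem_succs.2 ha⟩
      refine ⟨g, mem_succs.1 hg, ?_⟩
      simp only [hf, Nat.add_eq_zero_iff, one_ne_zero, and_false, if_false]
      refine ENNReal.div_le_of_le_mul ?_
      have hYsum : ∑ j ∈ succs G i, Y k j = ENNReal.ofReal (odds G i) * Y (k + 1) i := by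
        simp only [hY]
        rw [← ENNReal.ofReal_sum_of_nonneg fun j _ => (propMatrix_pow_mulVec_pos k hy j).le,
          ← ENNReal.ofReal_mul (odds_nonneg i), propMatrix_pow_succ_mulVec, propMatrix_mulVec hi,
          mul_div_cancel₀ _ (odds_pos hi).ne']
      calc x (k + 1) i ≤ ∑ j, σ.choose h i 1 j * x k j := hxN k h i hi
        _ = ∑ j ∈ succs G i, σ.choose h i 1 j * x k j :=
          sum_eq_sum_succs fun j hj => by rw [choose_eq_zero σ hi hj, zero_mul]
        _ ≤ ∑ j ∈ succs G i, σ.choose h i 1 g * f k g * Y k j := by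
          refine Finset.sum_le_sum fun j hj => ?_
          calc σ.choose h i 1 j * x k j ≤ σ.choose h i 1 j * (f k j * Y k j) :=
                mul_le_mul_right (hxf k j) _
            _ = σ.choose h i 1 j * f k j * Y k j := (mul_assoc _ _ _).symm
            _ ≤ _ := mul_le_mul_left (hmax j hj) _
        _ = _ := by
          rw [← Finset.mul_sum, hYsum]
          simp only [hf]
          ring)
    K i
  exact ⟨τ, (hxf K i).trans (mul_le_mul_left hτ _)⟩

/-- Against any Chooser, a Guesser who knows his strategy has payoff at least `1 / (M ^ K y) i` for
every horizon `K`, where `M ^ K y` tends to `u`. -/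
lemma le_iSup_payoff {u : V → ℝ} (hu : ∀ i, 0 < u i)
    (hval : ∀ k, IsTerminal G k → 0 < val k)
    (hlim : ∀ y : V → ℝ, (∀ k, IsTerminal G k → y k = (val k)⁻¹) →
      Tendsto (fun s : ℕ => propMatrix G ^ s *ᵥ y) atTop (𝓝 u))
    (σ : ChooserStrategy G) (i : V) : ENNReal.ofReal (u i)⁻¹ ≤ ⨆ τ, payoff val σ τ i := by
  obtain ⟨c, hc, hc1, hcval⟩ := exists_pos_le_val hval
  have hpos : ∀ i, 0 < if IsTerminal G i then val i else c := by
    intro i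
    split_ifs with hi
    · exact hval i hi
    · exact hc
  set y : V → ℝ := fun i => (if IsTerminal G i then val i else c)⁻¹ with hy
  have hbound : ∀ K : ℕ, 1 ≤ (⨆ τ, payoff val σ τ i) *
      ENNReal.ofReal ((propMatrix G ^ K *ᵥ y) i) := by
    intro K
    obtain ⟨τ, hτ⟩ := exists_le_payoff_mul (σ := σ) hc hc1 hcval (y := y)
      (fun i => inv_pos.2 (hpos i)) (x := fun _ _ => 1)
      (fun i => by rw [← ENNReal.ofReal_mul (hpos i).le, mul_inv_cancel₀ (hpos i).ne']; simp)
      (fun _ _ _ => rfl) (fun k h i _ => by simp [sum_pmf]) K i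
    exact hτ.trans (mul_le_mul_left (le_iSup (fun τ => payoff val σ τ i) τ) _)
  have hYlim := ENNReal.tendsto_ofReal (tendsto_pi_nhds.1 (hlim y
    fun k hk => by simp [hy, hk]) i)
  have := ge_of_tendsto' (ENNReal.Tendsto.const_mul (a := ⨆ τ, payoff val σ τ i) hYlim
    (Or.inl (ENNReal.ofReal_pos.2 (hu i)).ne')) hbound
  rw [ENNReal.ofReal_inv_of_pos (hu i), ← one_div]
  exact ENNReal.div_le_of_le_mul this

/-- If a positional Chooser could avoid the terminal vertices with positive probability, then
the Guesser could bet on this, at the expense of the terminal vertices, without bound. -/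
lemma endsAS_of_iSup_payoff_ne_top (hG : IsTerminating G)
    (hval : ∀ k, IsTerminal G k → 0 < val k) (hσ : σ.IsPositional) {i : V}
    (htop : ⨆ τ, payoff val σ τ i ≠ ⊤) (τ : GuesserStrategy G) : EndsAS σ τ i := by
  obtain ⟨c, hc, hc1, hcval⟩ := exists_pos_le_val hval
  -- `x k` is the probability of surviving `k` rounds, as a function of the starting vertex
  let x : ℕ → V → ℝ≥0∞ := fun k => (fun (z : V → ℝ≥0∞) i =>
    if IsTerminal G i then z i else ∑ j, σ.choose [] i 0 j * z j)^[k]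
      (fun i => if IsTerminal G i then 0 else 1)
  have hxsucc : ∀ k i, x (k + 1) i =
      if IsTerminal G i then x k i else ∑ j, σ.choose [] i 0 j * x k j := fun k i => by
    simp only [x, Function.iterate_succ_apply']
  have hxT : ∀ k i, IsTerminal G i → x (k + 1) i = x k i := fun k i hi => by
    rw [hxsucc, if_pos hi]
  have hxN : ∀ k h i w, ¬ IsTerminal G i → x (k + 1) i = ∑ j, σ.choose h i w j * x k j :=
    fun k h i w hi => by rw [hxsucc, if_neg hi, hσ [] h i 0 w hi]
  have hxT0 : ∀ k i, IsTerminal G i → x k i = x 0 i := fun k i hi => by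
    induction k with
    | zero => rfl
    | succ k ih => rw [hxT k i hi, ih]
  have hsurv : ∀ t, survival σ τ i t = x t i := fun t =>
    expect_law_eq_iterate (σ := σ) (τ := τ) hxT hxN i t 0
  rw [endsAS_iff_survival]
  set S := ⨆ τ, payoff val σ τ i
  have hbound : ∀ t : ℕ, survival σ τ i t ≤
      S * ENNReal.ofReal (1 / ((t : ℝ) + 1) + c⁻¹ * (propMatrix G ^ t *ᵥ nonterminalInd G) i) := by
    intro t
    have hη : 0 < 1 / ((t : ℝ) + 1) := by positivity
    set y : V → ℝ := fun i => if IsTerminal G i then 1 / ((t : ℝ) + 1) else c⁻¹ with hy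
    obtain ⟨τ', hτ'⟩ := exists_le_payoff_mul (σ := σ) hc hc1 hcval (y := y)
      (fun i => by
        simp only [hy]
        split_ifs
        · exact hη
        · exact inv_pos.2 hc) (x := x)
      (fun i => by
        by_cases hi : IsTerminal G i
        · simp [x, hi]
        · simp only [x, hi, hy, Function.iterate_zero, id_eq, if_false]
          rw [← ENNReal.ofReal_mul hc.le, mul_inv_cancel₀ hc.ne', ENNReal.ofReal_one])
      hxT0 (fun k h i hi => (hxN k h i 1 hi).le) t i
    rw [hsurv]
    refine hτ'.trans (mul_le_mul' (le_iSup (fun τ => payoff val σ τ i) τ')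
      (ENNReal.ofReal_le_ofReal ?_))
    have hyle : y ≤ (fun _ => 1 / ((t : ℝ) + 1)) + c⁻¹ • nonterminalInd G := by
      intro j
      simp only [hy, Pi.add_apply, Pi.smul_apply, nonterminalInd, smul_eq_mul]
      split_ifs
      · simp
      · linarith
    have h1 := propMatrix_pow_mulVec_mono (G := G) t hyle i
    rw [Matrix.mulVec_add, Matrix.mulVec_smul] at h1
    exact h1.trans (add_le_add_left (propMatrix_pow_mulVec_const_le hη.le t i) _)
  have h0 := tendsto_one_div_add_atTop_nhds_zero_nat (𝕜 := ℝ)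
  have h1 := h0.add ((tendsto_pi_nhds.1 (tendsto_pow_mulVec_nonterminalInd hG) i).const_mul c⁻¹)
  have h2 := ENNReal.Tendsto.const_mul (ENNReal.tendsto_ofReal h1) (Or.inr htop)
  simp only [Pi.zero_apply, mul_zero, add_zero, ENNReal.ofReal_zero] at h2
  exact tendsto_of_tendsto_of_tendsto_of_le_of_le tendsto_const_nhds h2 (fun _ => zero_le) hbound

end GreedyGuesser

end PathGuessing

/-! ### Optimal play -/

theorem mainTheorem1 {V : Type*} [Fintype V] [DecidableEq V] (G : Digraph V)
    [DecidableRel G.Adj] (val : V → ℝ) (hG : PathGuessing.IsTerminating G)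
    (hval : ∀ k, PathGuessing.IsTerminal G k → 0 < val k) :
    ∃ u : V → ℝ,
      -- the limiting reciprocal values
      Tendsto (fun s : ℕ => (PathGuessing.propMatrix G ^ s) *ᵥ PathGuessing.initialRecip G val)
        atTop (𝓝 u) ∧
      (∀ i, 0 < u i) ∧
      PathGuessing.propMatrix G *ᵥ u = u ∧
      (∀ x : V → ℝ, PathGuessing.propMatrix G *ᵥ x = x →
        (∀ k, PathGuessing.IsTerminal G k → x k = (val k)⁻¹) → x = u) ∧
      -- the limiting strategies exist
      (∃ σ : PathGuessing.ChooserStrategy G, PathGuessing.IsLimitingChooser u σ) ∧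
      (∀ β ∈ Set.Icc (0 : ℝ) 1,
        ∃ τ : PathGuessing.GuesserStrategy G, PathGuessing.IsLimitingGuesser u β τ) ∧
      -- the limiting strategy of the Chooser is optimal
      (∀ σ : PathGuessing.ChooserStrategy G, PathGuessing.IsLimitingChooser u σ → ∀ i,
        PathGuessing.ChooserOptimal val σ i ∧
        ∀ τ : PathGuessing.GuesserStrategy G, PathGuessing.EndsAS σ τ i ∧
          PathGuessing.finalFortune val σ τ i ≤ ENNReal.ofReal (u i)⁻¹) ∧
      -- the limiting strategies of the Guesser are optimal
      (∀ β ∈ Set.Icc (0 : ℝ) 1, ∀ τ : PathGuessing.GuesserStrategy G,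
        PathGuessing.IsLimitingGuesser u β τ → ∀ i,
        PathGuessing.GuesserOptimal val τ i ∧
        ∀ σ : PathGuessing.ChooserStrategy G, σ.IsGuessBlind → PathGuessing.EndsAS σ τ i →
          PathGuessing.finalFortune val σ τ i = ENNReal.ofReal (u i)⁻¹) ∧
      -- optimal positional play ends almost surely, and its values are the limiting values
      (∀ (i : V) (σ : PathGuessing.ChooserStrategy G), σ.IsPositional →
        PathGuessing.ChooserOptimal val σ i →
        ∀ τ : PathGuessing.GuesserStrategy G, PathGuessing.EndsAS σ τ i ∧
          (PathGuessing.GuesserOptimal val τ i →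
            PathGuessing.finalFortune val σ τ i = ENNReal.ofReal (u i)⁻¹)) := by
  obtain ⟨u, hu, hfix, huT, hlim⟩ := PathGuessing.exists_limit hG hval
  have hopt : ∀ (σ : PathGuessing.ChooserStrategy G) (i : V),
      ENNReal.ofReal (u i)⁻¹ ≤ ⨆ τ, PathGuessing.payoff val σ τ i :=
    PathGuessing.le_iSup_payoff hu hval hlim
  refine ⟨u, hlim _ fun k hk => by simp [PathGuessing.initialRecip, hk], hu, hfix, ?_,
    PathGuessing.exists_limitingChooser hu hfix,
    fun β hβ => PathGuessing.exists_limitingGuesser hu hfix hβ, ?_, ?_, ?_⟩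
  · intro x hx hxT
    refine sub_eq_zero.1 (PathGuessing.eq_zero_of_fixed hG (x := x - u) ?_ ?_)
    · rw [Matrix.mulVec_sub, hx, hfix]
    · intro k hk
      simp [hxT k hk, huT k hk]
  · intro σ hσ i
    refine ⟨fun σ' => le_trans (iSup_le fun τ => ?_) (hopt σ' i), fun τ => ⟨?_, ?_⟩⟩
    · exact PathGuessing.payoff_limitingChooser_le hG hu hfix huT hσ i
    · exact PathGuessing.endsAS_limitingChooser hG hu hfix hσ i
    · exact PathGuessing.finalFortune_limitingChooser_le hu hfix huT hσ i
  · intro β hβ τ hτ i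
    refine ⟨fun τ' => ?_, fun σ hσ hend => ?_⟩
    · exact (PathGuessing.guarantee_le hG hu hfix huT τ' i).trans
        (PathGuessing.le_guarantee_limitingGuesser hu hfix huT hβ hτ i)
    · exact PathGuessing.finalFortune_limitingGuesser hu hfix huT hβ hτ hσ hend
  · intro i σ hpos hσ τ
    obtain ⟨σ₀, hσ₀⟩ := PathGuessing.exists_limitingChooser hu hfix
    have hsup : ⨆ τ, PathGuessing.payoff val σ τ i ≤ ENNReal.ofReal (u i)⁻¹ :=
      (hσ σ₀).trans (iSup_le fun τ =>
        PathGuessing.payoff_limitingChooser_le hG hu hfix huT hσ₀ i)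
    have hend : PathGuessing.EndsAS σ τ i := PathGuessing.endsAS_of_iSup_payoff_ne_top hG hval hpos
      (ne_top_of_le_ne_top ENNReal.ofReal_ne_top hsup) τ
    refine ⟨hend, fun hτ => le_antisymm ?_ ?_⟩
    · exact (PathGuessing.finalFortune_le_payoff val i).trans
        ((le_iSup (fun τ => PathGuessing.payoff val σ τ i) τ).trans hsup)
    · have hblind : σ.IsGuessBlind := fun h h' i w hi _ => hpos h h' i w w hi
      obtain ⟨τ₀, hτ₀⟩ := PathGuessing.exists_limitingGuesser hu hfix
        (β := 0) ⟨le_rfl, zero_le_one⟩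
      calc ENNReal.ofReal (u i)⁻¹ ≤ PathGuessing.guarantee val τ₀ i :=
            PathGuessing.le_guarantee_limitingGuesser hu hfix huT ⟨le_rfl, zero_le_one⟩ hτ₀ i
        _ ≤ PathGuessing.guarantee val τ i := hτ τ₀
        _ ≤ PathGuessing.finalFortune val σ τ i :=
            iInf_le_of_le σ (iInf_le_of_le hblind (iInf_le_of_le hend le_rfl))
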